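/- For a finite multigraph $G=(V,E)$ and $q,w\in\mathbb{C}$ let $$Z_T(G)(q,w)=\sum_{A\subseteq E}q^{k(A)}w^{|A|},$$ where $k(A)$ is the number of connected components of the graph $(V,A)$. For $\varepsilon>0$, a complex number $\xi\neq 0$ is called a multiplicative $\varepsilon$-approximation to a complex number $z\ne 0$ if $e^{-\varepsilon}\le |z|/|\xi|\le e^{\varepsilon}$ and the angle between $\xi$ and $z$, seen as vectors in $\mathbb{C}=\mathbb{R}^2$, is at most $\varepsilon$. **Theorem.** Let $\Delta\in\mathbb{N}$ and $w\in\mathbb{C}$. There is a constant $K$, depending only on $\Delta$ and $w$, such that for every $q\in\mathbb{C}$ with $|q|>K$ there is a deterministic algorithm which, given a finite loopless multigraph $G=(V,E)$ of maximum degree at most $\Delta$ and a real number $\varepsilon>0$, computes a multiplicative $\varepsilon$-approximation to $Z_T(G)(q,w)$ (in particular, $Z_T(G)(q,w)\neq 0$) in time $(|V|/\varepsilon)^{O(1)}$. Here the running time is at most $C\,\bigl(\max(|V|,1)/\min(\varepsilon,1)\bigr)^{C}$ for a constant $C$ that does not depend on $G$ and $\varepsilon$. An algorithm is a program for a random access machine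 with memory cells for natural numbers (which can be added, subtracted, compared, and used as addresses) and for complex numbers (which can be added, subtracted, multiplied, divided, and compared by their real parts), each operation taking one unit of time. The multigraph is given by a list of its edges with respect to an arbitrary numbering of the vertices and edges, and $q$, $w$, $\varepsilon$ are given as complex numbers. -/

import Mathlib

open scoped Graph

/-! ### Multigraphs and the random-cluster form of the Tutte polynomial

Multigraphs are Mathlib's `Graph α β`: a vertex set `V(G)`, an edge set `E(G)` and the relation
`G.IsLink e x y` saying that `x` and `y` are the ends of the edge `e`. -/

namespace Graph

/-- The degree of a vertex: the number of incident edges, a loop being counted twice. -/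
noncomputable def degree {α β : Type*} (G : Graph α β) (v : α) : ℕ :=
  (G.incidenceSet v).ncard + (G.loopSet v).ncard

/-- The number of connected components: `Quot` is the quotient of the vertex set by the
equivalence relation generated by adjacency. -/
noncomputable def numComponents {α β : Type*} (G : Graph α β) : ℕ :=
  Nat.card (Quot fun x y : V(G) => G.Adj x.1 y.1)

/-- `Z_T(G)(q, w) = ∑_{A ⊆ E} q ^ k(A) * w ^ |A|`, where `k(A)` is the number of components of
the graph `(V, A)`. (A finite sum, as `E(G)` is finite wherever this is used.) -/
noncomputable def tutte {α β : Type*} (G : Graph α β) (q w : ℂ) : ℂ :=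
  ∑ᶠ A ∈ 𝒫 E(G), q ^ (G.restrict A).numComponents * w ^ A.ncard

/-- A presentation of a finite multigraph as an edge list: the vertices are numbered
`0, …, n - 1`, the edges `0, …, m - 1`, and the two ends of each edge are listed. -/
structure EdgeList {α β : Type*} (G : Graph α β) where
  n : ℕ
  m : ℕ
  vert : Fin n ≃ V(G)
  edge : Fin m ≃ E(G)
  fst : Fin m → Fin n
  snd : Fin m → Fin n
  isLink : ∀ i, G.IsLink (edge i) (vert (fst i)) (vert (snd i))

end Graph

/-- `ξ` is a multiplicative `ε`-approximation to `z`. -/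
def IsMultApprox (ε : ℝ) (z ξ : ℂ) : Prop :=
  z ≠ 0 ∧ ξ ≠ 0 ∧ Real.exp (-ε) ≤ ‖z‖ / ‖ξ‖ ∧ ‖z‖ / ‖ξ‖ ≤ Real.exp ε ∧
    InnerProductGeometry.angle ξ z ≤ ε

/-! ### Deterministic algorithms: a random access machine with exact complex arithmetic

The memory consists of countably many arrays of natural numbers and countably many arrays of
complex numbers. Natural numbers are added, subtracted (truncated at `0`) and compared, and serve
as array indices; complex numbers are added, subtracted, multiplied and divided, and their real
parts are compared. Every operation costs one unit of time. No complex constants are built in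
except those obtained from natural numbers, and no rounding of complex numbers to natural numbers
is available. A program is a finite text; it mentions only finitely many of the arrays. -/

namespace ComplexRAM

/-- A memory configuration: `s.nat x i` and `s.num x i` are the `i`-th entries of the `x`-th array
of natural numbers and of the `x`-th array of complex numbers. -/
structure State where
  nat : ℕ → ℕ → ℕ
  num : ℕ → ℕ → ℂ

/-- Write `v` to the entry `i` of the array `x` of natural numbers. -/
def State.setNat (s : State) (x i v : ℕ) : State :=
  { s with nat := Function.update s.nat x (Function.update (s.nat x) i v) }

/-- Write `v` to the entry `i` of the array `x` of complex numbers. -/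
noncomputable def State.setNum (s : State) (x i : ℕ) (v : ℂ) : State :=
  { s with num := Function.update s.num x (Function.update (s.num x) i v) }

/-- Expressions for natural numbers; `get x i` reads the entry `i` of the array `x`. -/
inductive NatExp
  | const (c : ℕ)
  | get (x : ℕ) (i : NatExp)
  | add (a b : NatExp)
  | sub (a b : NatExp)

def NatExp.eval (s : State) : NatExp → ℕ
  | const c => c
  | get x i => s.nat x (i.eval s)
  | add a b => a.eval s + b.eval s
  | sub a b => a.eval s - b.eval s

/-- The number of operations needed to evaluate an expression. -/
def NatExp.cost : NatExp → ℕ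
  | const _ => 1
  | get _ i => i.cost + 1
  | add a b => a.cost + b.cost + 1
  | sub a b => a.cost + b.cost + 1

/-- Expressions for complex numbers; `ofNat` converts a natural number to a complex number. -/
inductive NumExp
  | ofNat (a : NatExp)
  | get (x : ℕ) (i : NatExp)
  | add (a b : NumExp)
  | sub (a b : NumExp)
  | mul (a b : NumExp)
  | div (a b : NumExp)

noncomputable def NumExp.eval (s : State) : NumExp → ℂ
  | ofNat a => (a.eval s : ℂ)
  | get x i => s.num x (i.eval s)
  | add a b => a.eval s + b.eval s
  | sub a b => a.eval s - b.eval s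
  | mul a b => a.eval s * b.eval s
  | div a b => a.eval s / b.eval s

/-- The number of operations needed to evaluate an expression. -/
def NumExp.cost : NumExp → ℕ
  | ofNat a => a.cost + 1
  | get _ i => i.cost + 1
  | add a b => a.cost + b.cost + 1
  | sub a b => a.cost + b.cost + 1
  | mul a b => a.cost + b.cost + 1
  | div a b => a.cost + b.cost + 1

/-- Tests: `a ≤ b` for natural numbers, and `Re a ≤ Re b` for complex numbers. -/
inductive Test
  | natLe (a b : NatExp)
  | reLe (a b : NumExp)

def Test.Holds (s : State) : Test → Prop
  | natLe a b => a.eval s ≤ b.eval s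
  | reLe a b => (a.eval s).re ≤ (b.eval s).re

def Test.cost : Test → ℕ
  | natLe a b => a.cost + b.cost + 1
  | reLe a b => a.cost + b.cost + 1

/-- Programs: do nothing; assign the value of an expression to the entry `i` of the array `x`;
sequential composition; `if b then p else p'`; `while b do p`. -/
inductive Program
  | skip
  | setNat (x : ℕ) (i e : NatExp)
  | setNum (x : ℕ) (i : NatExp) (e : NumExp)
  | seq (p p' : Program)
  | branch (b : Test) (p p' : Program)
  | loop (b : Test) (p : Program)

/-- `Exec p s s' t`: started in the memory configuration `s`, the program `p` halts after exactly
`t` steps in the memory configuration `s'`. -/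
inductive Exec : Program → State → State → ℕ → Prop
  | skip (s : State) : Exec .skip s s 1
  | setNat (s : State) (x : ℕ) (i e : NatExp) :
      Exec (.setNat x i e) s (s.setNat x (i.eval s) (e.eval s)) (i.cost + e.cost + 1)
  | setNum (s : State) (x : ℕ) (i : NatExp) (e : NumExp) :
      Exec (.setNum x i e) s (s.setNum x (i.eval s) (e.eval s)) (i.cost + e.cost + 1)
  | seq {p p' : Program} {s s' s'' : State} {t t' : ℕ} :
      Exec p s s' t → Exec p' s' s'' t' → Exec (.seq p p') s s'' (t + t')
  | branch_true {b : Test} {p p' : Program} {s s' : State} {t : ℕ} :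
      b.Holds s → Exec p s s' t → Exec (.branch b p p') s s' (b.cost + t)
  | branch_false {b : Test} {p p' : Program} {s s' : State} {t : ℕ} :
      ¬ b.Holds s → Exec p' s s' t → Exec (.branch b p p') s s' (b.cost + t)
  | loop_true {b : Test} {p : Program} {s s' s'' : State} {t t' : ℕ} :
      b.Holds s → Exec p s s' t → Exec (.loop b p) s' s'' t' →
        Exec (.loop b p) s s'' (b.cost + t + t')
  | loop_false {b : Test} {p : Program} {s : State} :
      ¬ b.Holds s → Exec (.loop b p) s s b.cost

/-- The machine is deterministic: the input determines the result and the running time. -/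
theorem Exec.deterministic {p : Program} {s s₁ s₂ : State} {t₁ t₂ : ℕ}
    (h₁ : Exec p s s₁ t₁) (h₂ : Exec p s s₂ t₂) : s₁ = s₂ ∧ t₁ = t₂ := by
  induction h₁ generalizing s₂ t₂ with
  | skip | setNat | setNum => cases h₂; exact ⟨rfl, rfl⟩
  | seq _ _ ih ih' =>
    cases h₂ with
    | seq k k' =>
      obtain ⟨rfl, rfl⟩ := ih k
      obtain ⟨rfl, rfl⟩ := ih' k'
      exact ⟨rfl, rfl⟩
  | branch_true hb _ ih =>
    cases h₂ with
    | branch_true _ k => obtain ⟨rfl, rfl⟩ := ih k; exact ⟨rfl, rfl⟩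
    | branch_false hb' _ => exact absurd hb hb'
  | branch_false hb _ ih =>
    cases h₂ with
    | branch_true hb' _ => exact absurd hb' hb
    | branch_false _ k => obtain ⟨rfl, rfl⟩ := ih k; exact ⟨rfl, rfl⟩
  | loop_true hb _ _ ih ih' =>
    cases h₂ with
    | loop_true _ k k' =>
      obtain ⟨rfl, rfl⟩ := ih k
      obtain ⟨rfl, rfl⟩ := ih' k'
      exact ⟨rfl, rfl⟩
    | loop_false hb' => exact absurd hb hb'
  | loop_false hb =>
    cases h₂ with
    | loop_true hb' _ _ => exact absurd hb' hb
    | loop_false _ => exact ⟨rfl, rfl⟩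

/-- The initial memory. Arrays `0` and `1` of natural numbers hold `|V|` and `|E|` in their entry
`0`, arrays `2` and `3` hold the first and the second ends of the edges; entry `0` of the arrays
`0`, `1` and `2` of complex numbers holds `q`, `w` and `ε`. Everything else is `0`. -/
noncomputable def input {α β : Type*} {G : Graph α β} (L : G.EdgeList) (q w : ℂ) (ε : ℝ) :
    State where
  nat x i :=
    match x with
    | 0 => if i = 0 then L.n else 0
    | 1 => if i = 0 then L.m else 0
    | 2 => if h : i < L.m then (L.fst ⟨i, h⟩ : ℕ) else 0
    | 3 => if h : i < L.m then (L.snd ⟨i, h⟩ : ℕ) else 0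
    | _ => 0
  num x i :=
    match x with
    | 0 => if i = 0 then q else 0
    | 1 => if i = 0 then w else 0
    | 2 => if i = 0 then (ε : ℂ) else 0
    | _ => 0

/-- The result of a computation: entry `0` of the array `3` of complex numbers. -/
def State.output (s : State) : ℂ := s.num 3 0

end ComplexRAM

/-! All edges between two vertices `u` and `v` are deleted or contracted at once. If there are `j`
of them, Z(E) = Z(cut) + c Z(merge) with c = ((1 + w)^j - 1) / q, and |c| is as small as desired,
uniformly in j ≤ Δ, once |q| is large. Loops encode deleted edges and a contracted vertex stays
behind as an isolated one, so that every graph in the argument has the same vertices and the same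
edge indices.

Let R(E, v) be the quotient of Z(E) by the sum without the edges at `v`. Deletion and contraction
become R(E, v) = R(cut, v) + c R(merge, v) / R(remove v E, u) (`ratio_recursion`). Contractions may
make the degree d of `v` large, but all other degrees stay at most Δ, and the denominator belongs to
such a vertex. Induction on the number of live edges gives |R - 1| ≤ (2^d - 1) / 2^(Δ+1), hence |R|
≥ 1/2 for d ≤ Δ, and also that no sum in the argument vanishes (`ratio_bound`).

The recursion contracts errors: measured in units of 4^d, the error at least halves at each level.
Replacing the ratios at depth `k` by 1 therefore costs at most 4^d / 2^k at the root
(`IsApproxRatio.bound`). Deleting the edges vertex by vertex writes Z as a product of the numbers q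
R, one for each vertex (`clusterSum_eq_prod_ratio`), so a depth K with 2^K of order n / ε suffices
(`isMultApprox_prod`).

The recursion trees are ternary, so the whole forest has at most n 4^K nodes, a polynomial in n / ε;
each node costs O(m + 1) steps and m ≤ nΔ. Arithmetic is exact, so truncation is the only source of
error. The program builds the forest breadth first and evaluates it backwards
(`exists_runs_growLoop`, `exists_runs_evaluateLoop`). -/

/-! ### The random-cluster sum of an edge family -/

namespace EdgeFamily

variable {ι V : Type*}

/-- The number of components of the graph on `V` with edges `E i`, `i ∈ A`. -/
noncomputable def comps (E : ι → V × V) (A : Finset ι) : ℕ :=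
  Nat.card (Quot fun x y => ∃ i ∈ A, E i = (x, y))

/-- Relabel `u` as `v`. -/
def relabel [DecidableEq V] (u v x : V) : V := if x = u then v else x

/-- Contract `u` into `v`; the vertex `u` stays as an isolated vertex. -/
def merge [DecidableEq V] (u v : V) (E : ι → V × V) : ι → V × V :=
  fun i => (relabel u v (E i).1, relabel u v (E i).2)

/-- Turn the edges between `u` and `v` into loops. -/
def cut [DecidableEq V] (u v : V) (E : ι → V × V) : ι → V × V :=
  fun i => if relabel u v (E i).1 = relabel u v (E i).2 then ((E i).1, (E i).1) else E i

/-- Turn the edges at `v` into loops. -/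
def remove [DecidableEq V] (v : V) (E : ι → V × V) : ι → V × V :=
  fun i => if (E i).1 = v ∨ (E i).2 = v then ((E i).1, (E i).1) else E i

theorem comps_congr {E E' : ι → V × V} {A : Finset ι} (h : ∀ i ∈ A, E i = E' i) :
    comps E A = comps E' A := by
  have : (fun x y => ∃ i ∈ A, E i = (x, y)) = fun x y => ∃ i ∈ A, E' i = (x, y) := by
    funext x y
    refine propext ⟨?_, ?_⟩ <;> rintro ⟨i, hi, e⟩ <;> refine ⟨i, hi, ?_⟩
    · rw [← h i hi, e]
    · rw [h i hi, e]
  rw [comps, comps, this]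

/-- Both operations turn an edge into the loop at its first end, so the families coincide, not
merely their cluster sums. -/
theorem remove_cut [DecidableEq V] (u v : V) (E : ι → V × V) (huv : u ≠ v) :
    remove v (cut u v E) = remove v E := by
  funext i
  simp only [remove, cut, relabel]
  have := Prod.mk.eta (p := E i)
  grind

variable [Fintype ι] [DecidableEq V]

/-- The edges that are not loops. Loops play the role of deleted edges. -/
def live (E : ι → V × V) : Finset ι := Finset.univ.filter fun i => (E i).1 ≠ (E i).2

/-- The number of live edges at a vertex. -/
def liveDegree (E : ι → V × V) (v : V) : ℕ :=
  ((live E).filter fun i => (E i).1 = v ∨ (E i).2 = v).card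

/-- The live edges between `u` and `v`. -/
def between (u v : V) (E : ι → V × V) : Finset ι :=
  (live E).filter fun i => relabel u v (E i).1 = relabel u v (E i).2

/-- The sum of `q ^ k(A) * w ^ |A|` over the sets `A` of live edges. -/
noncomputable def clusterSum (q w : ℂ) (E : ι → V × V) : ℂ :=
  ∑ A ∈ (live E).powerset, q ^ comps E A * w ^ A.card

/-- Loops do not enter the sum, so it is immaterial at which vertex a deleted edge has become a
loop. Identities between iterated deletions and contractions are needed only up to this ambiguity.
-/
theorem clusterSum_congr (q w : ℂ) {E E' : ι → V × V}
    (h : ∀ i, E i = E' i ∨ (E i).1 = (E i).2 ∧ (E' i).1 = (E' i).2) :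
    clusterSum q w E = clusterSum q w E' := by
  have hl : live E = live E' := by
    ext i
    simp only [live, Finset.mem_filter, Finset.mem_univ, true_and]
    rcases h i with e | ⟨e, e'⟩
    · rw [e]
    · simp [e, e']
  rw [clusterSum, clusterSum, ← hl]
  refine Finset.sum_congr rfl fun A hA => ?_
  rw [comps_congr fun i hi => ?_]
  have := Finset.mem_powerset.1 hA hi
  rcases h i with e | ⟨e, -⟩
  · exact e
  · exact absurd e (Finset.mem_filter.1 this).2

/-! ### Deletion and contraction of parallel edges -/

theorem live_merge [DecidableEq ι] (u v : V) (E : ι → V × V) :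
    live (merge u v E) = live E \ between u v E := by
  ext i
  simp only [live, merge, between, Finset.mem_filter, Finset.mem_univ, true_and, Finset.mem_sdiff]
  grind

theorem live_cut [DecidableEq ι] (u v : V) (E : ι → V × V) :
    live (cut u v E) = live E \ between u v E := by
  ext i
  simp only [live, cut, between, Finset.mem_filter, Finset.mem_univ, true_and, Finset.mem_sdiff]
  grind

theorem mem_between {u v : V} {E : ι → V × V} {i : ι} (h : i ∈ between u v E) :
    E i = (u, v) ∨ E i = (v, u) := by
  simp only [between, live, relabel] at h
  have := Prod.mk.eta (p := E i)
  grind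

/-- The extra component is the vertex `u`, left isolated by the contraction; it corresponds to
`none`. Relabelling `u` as `v` does not change a class of the original graph because `C` joins the
two. The extra component is the source of the factor 1/q in the recursion. -/
theorem comps_contract [Finite V] [DecidableEq ι] {u v : V} (huv : u ≠ v) (E : ι → V × V)
    {B C : Finset ι} (hC : C ⊆ between u v E) (hne : C.Nonempty) :
    comps E (B ∪ C) + 1 = comps (merge u v E) B := by
  classical
  rw [comps, comps, ← Finite.card_option]
  set r₁ : V → V → Prop := fun x y => ∃ i ∈ B ∪ C, E i = (x, y) with hr₁
  set r₂ : V → V → Prop := fun x y => ∃ i ∈ B, merge u v E i = (x, y) with hr₂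
  have hv : relabel u v v = v := by simp [relabel]
  have hu : relabel u v u = v := by simp [relabel]
  have hnu (x : V) : relabel u v x ≠ u := by
    unfold relabel; split_ifs with h
    · exact huv.symm
    · exact h
  have huv₁ : Quot.mk r₁ u = Quot.mk r₁ v := by
    obtain ⟨i, hi⟩ := hne
    have hm : i ∈ B ∪ C := Finset.mem_union_right _ hi
    rcases mem_between (hC hi) with e | e
    · exact Quot.sound ⟨i, hm, e⟩
    · exact (Quot.sound ⟨i, hm, e⟩).symm
  have hrel (x : V) : Quot.mk r₁ (relabel u v x) = Quot.mk r₁ x := by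
    unfold relabel; split_ifs with h
    · rw [h, huv₁]
    · rfl
  refine (Nat.card_congr
    { toFun := Quot.lift (fun x => if x = u then none else some (Quot.mk r₁ x)) ?_
      invFun := fun o => o.elim (Quot.mk r₂ u)
        (Quot.lift (fun x => Quot.mk r₂ (relabel u v x)) ?_)
      left_inv := ?_
      right_inv := ?_ }).symm
  · rintro x y ⟨i, hi, e⟩
    simp only [merge, Prod.mk.injEq] at e
    obtain ⟨rfl, rfl⟩ := e
    rw [if_neg (hnu _), if_neg (hnu _), hrel, hrel]
    exact congrArg some (Quot.sound ⟨i, Finset.mem_union_left _ hi, rfl⟩)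
  · rintro x y ⟨i, hi, e⟩
    rcases Finset.mem_union.1 hi with hi | hi
    · refine Quot.sound ⟨i, hi, ?_⟩
      simp [merge, e]
    · rcases mem_between (hC hi) with e' | e' <;> rw [e] at e' <;> cases e' <;> rw [hu, hv]
  · rintro ⟨x⟩
    change Option.elim (if x = u then none else some (Quot.mk r₁ x)) _ _ = Quot.mk r₂ x
    split_ifs with h
    · rw [h]; rfl
    · change Quot.mk r₂ (relabel u v x) = _
      rw [relabel, if_neg h]
  · rintro (_ | x)
    · change (if u = u then none else _) = _
      rw [if_pos rfl]
    · induction x using Quot.ind with | _ x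
      change (if relabel u v x = u then none else some (Quot.mk r₁ (relabel u v x))) = _
      rw [if_neg (hnu x), hrel]

theorem sum_powerset_union {ι M : Type*} [DecidableEq ι] [AddCommMonoid M] {s t : Finset ι}
    (h : Disjoint s t) (f : Finset ι → M) :
    ∑ A ∈ (s ∪ t).powerset, f A = ∑ B ∈ s.powerset, ∑ C ∈ t.powerset, f (B ∪ C) := by
  rw [← Finset.sum_product']
  symm
  refine Finset.sum_bij' (fun p _ => p.1 ∪ p.2) (fun A _ => (A ∩ s, A ∩ t)) ?_ ?_ ?_ ?_ ?_
  · rintro ⟨B, C⟩ hp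
    simp only [Finset.mem_product, Finset.mem_powerset] at hp ⊢
    exact Finset.union_subset_union hp.1 hp.2
  · intro A _
    simp
  · rintro ⟨B, C⟩ hp
    simp only [Finset.mem_product, Finset.mem_powerset] at hp
    have h1 : B ∩ t = ∅ := Finset.disjoint_iff_inter_eq_empty.1 (h.mono_left hp.1)
    have h2 : C ∩ s = ∅ := Finset.disjoint_iff_inter_eq_empty.1 (h.symm.mono_left hp.2)
    simp [Finset.union_inter_distrib_right, h1, h2, Finset.inter_eq_left.2 hp.1,
      Finset.inter_eq_left.2 hp.2]
  · intro A hA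
    rw [Finset.mem_powerset] at hA
    simp only
    rw [← Finset.inter_union_distrib_left, Finset.inter_eq_left.2 hA]
  · simp

/-- Deletion and contraction of all edges between `u` and `v` at once. -/
theorem clusterSum_eq_cut_add_merge [Finite V] {q : ℂ} (hq : q ≠ 0) (w : ℂ) {u v : V}
    (huv : u ≠ v) (E : ι → V × V) :
    clusterSum q w E = clusterSum q w (cut u v E) +
      ((1 + w) ^ (between u v E).card - 1) / q * clusterSum q w (merge u v E) := by
  classical
  set P := between u v E with hP
  have hPl : P ⊆ live E := Finset.filter_subset _ _
  have hd : Disjoint (live E \ P) P := Finset.sdiff_disjoint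
  rw [clusterSum, ← Finset.sdiff_union_of_subset hPl, sum_powerset_union hd, clusterSum, clusterSum,
    live_cut, live_merge, ← hP, Finset.mul_sum, ← Finset.sum_add_distrib]
  refine Finset.sum_congr rfl fun B hB => ?_
  rw [Finset.mem_powerset] at hB
  -- The empty `C` gives the term of `cut`. For nonempty `C` the number of components does not
  -- depend on `C`, and the weights w^|C| add up to (1 + w)^|P| - 1.
  rw [← Finset.add_sum_erase _ _ (Finset.empty_mem_powerset P)]
  congr 1
  · rw [Finset.union_empty, comps_congr fun i hi => ?_]
    have hi' := hB hi
    simp only [P, between, Finset.mem_sdiff, Finset.mem_filter] at hi'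
    rw [cut, if_neg fun e => hi'.2 ⟨hi'.1, e⟩]
  · have key : ∀ C ∈ P.powerset.erase ∅, q ^ comps E (B ∪ C) * w ^ (B ∪ C).card =
        w ^ C.card * (q⁻¹ * (q ^ comps (merge u v E) B * w ^ B.card)) := by
      intro C hC
      rw [Finset.mem_erase, Finset.mem_powerset] at hC
      rw [← comps_contract huv E (B := B) hC.2 (Finset.nonempty_iff_ne_empty.2 hC.1),
        Finset.card_union_of_disjoint (hd.mono hB hC.2)]
      field_simp
      ring
    rw [Finset.sum_congr rfl key, ← Finset.sum_mul]
    have hs : ∑ C ∈ P.powerset.erase ∅, w ^ C.card = (1 + w) ^ P.card - 1 := by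
      have := Finset.sum_pow_mul_eq_add_pow w 1 P
      rw [← Finset.add_sum_erase _ _ (Finset.empty_mem_powerset P)] at this
      simp only [Finset.card_empty, pow_zero, one_pow, mul_one] at this
      rw [add_comm 1 w, ← this]; ring
    rw [hs]; ring

/-- After the contraction the edges formerly at `u` sit at `v` and are deleted with it. The loops
may end up at different vertices, so only the sums agree. -/
theorem clusterSum_remove_merge (q w : ℂ) {u v : V} (huv : u ≠ v) (E : ι → V × V) :
    clusterSum q w (remove v (merge u v E)) = clusterSum q w (remove u (remove v E)) := by
  refine clusterSum_congr q w fun i => ?_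
  simp only [remove, merge, relabel]
  have := Prod.mk.eta (p := E i)
  grind

/-! ### Degrees and numbers of live edges under the operations -/

theorem liveDegree_cut_le (u v x : V) (E : ι → V × V) :
    liveDegree (cut u v E) x ≤ liveDegree E x := by
  refine Finset.card_le_card fun i => ?_
  simp only [live, cut, Finset.mem_filter, Finset.mem_univ, true_and]
  grind

theorem liveDegree_cut_lt {u v : V} {E : ι → V × V} (h : (between u v E).Nonempty) :
    liveDegree (cut u v E) v < liveDegree E v := by
  obtain ⟨i, hi⟩ := h
  refine Finset.card_lt_card (Finset.ssubset_iff_of_subset (fun i => ?_) |>.2 ⟨i, ?_, ?_⟩)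
  · simp only [live, cut, Finset.mem_filter, Finset.mem_univ, true_and]
    grind
  · have h1 := (Finset.mem_filter.1 hi).1
    rcases mem_between hi with e | e <;> simp [h1, e]
  · have h1 := (Finset.mem_filter.1 hi).2
    intro h
    exact (Finset.mem_filter.1 (Finset.mem_filter.1 h).1).2 (by simp [cut, h1])

/-- A live edge at `v` after the contraction had an end at `u` or at `v` before. This is the only
way in which a degree grows. -/
theorem liveDegree_merge_self_le (u v : V) (E : ι → V × V) :
    liveDegree (merge u v E) v ≤ liveDegree E v + liveDegree E u := by
  classical
  refine (Finset.card_le_card fun i => ?_).trans (Finset.card_union_le _ _)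
  simp only [live, merge, relabel, Finset.mem_filter, Finset.mem_univ, true_and, Finset.mem_union]
  grind

theorem liveDegree_merge_le {u v x : V} (hx : x ≠ v) (E : ι → V × V) :
    liveDegree (merge u v E) x ≤ liveDegree E x := by
  refine Finset.card_le_card fun i => ?_
  simp only [live, merge, relabel, Finset.mem_filter, Finset.mem_univ, true_and]
  grind

theorem liveDegree_remove_le (v x : V) (E : ι → V × V) :
    liveDegree (remove v E) x ≤ liveDegree E x := by
  refine Finset.card_le_card fun i => ?_
  simp only [live, remove, Finset.mem_filter, Finset.mem_univ, true_and]
  grind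

theorem card_between_le (u v : V) (E : ι → V × V) :
    (between u v E).card ≤ liveDegree E u := by
  refine Finset.card_le_card fun i hi => ?_
  have h1 := (Finset.mem_filter.1 hi).1
  rcases mem_between hi with e | e <;> simp [h1, e]

theorem card_live_cut_lt {u v : V} {E : ι → V × V} (h : (between u v E).Nonempty) :
    (live (cut u v E)).card < (live E).card := by
  classical
  rw [live_cut]
  exact Finset.card_lt_card (Finset.sdiff_ssubset (Finset.filter_subset _ _) h)

theorem card_live_merge_lt {u v : V} {E : ι → V × V} (h : (between u v E).Nonempty) :
    (live (merge u v E)).card < (live E).card := by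
  classical
  rw [live_merge]
  exact Finset.card_lt_card (Finset.sdiff_ssubset (Finset.filter_subset _ _) h)

theorem card_live_remove_lt {u v : V} {E : ι → V × V} (h : (between u v E).Nonempty) :
    (live (remove v E)).card < (live E).card := by
  obtain ⟨i, hi⟩ := h
  refine Finset.card_lt_card (Finset.ssubset_iff_of_subset (fun i => ?_) |>.2 ⟨i, ?_, ?_⟩)
  · simp only [live, remove, Finset.mem_filter, Finset.mem_univ, true_and]
    grind
  · exact (Finset.mem_filter.1 hi).1
  · intro h
    refine (Finset.mem_filter.1 h).2 ?_
    rcases mem_between hi with e | e <;> simp [remove, e]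

/-- A live edge has distinct ends, and for `u = v` relabelling would keep them distinct. -/
theorem ne_of_between {u v : V} {E : ι → V × V} (h : (between u v E).Nonempty) : u ≠ v := by
  obtain ⟨i, hi⟩ := h
  have h1 := (Finset.mem_filter.1 hi).1
  simp only [live, Finset.mem_filter, Finset.mem_univ, true_and] at h1
  rcases mem_between hi with e | e <;> rw [e] at h1
  · exact h1
  · exact h1.symm

theorem exists_between_of_liveDegree_ne_zero {v : V} {E : ι → V × V} (h : liveDegree E v ≠ 0) :
    ∃ u, (between u v E).Nonempty := by
  obtain ⟨i, hi⟩ := Finset.card_ne_zero.1 h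
  simp only [live, Finset.mem_filter, Finset.mem_univ, true_and] at hi
  rcases hi.2 with e | e
  · refine ⟨(E i).2, i, ?_⟩
    simp only [between, live, relabel]
    grind
  · refine ⟨(E i).1, i, ?_⟩
    simp only [between, live, relabel]
    grind

theorem clusterSum_remove_of_liveDegree_eq_zero (q w : ℂ) {v : V} {E : ι → V × V}
    (h : liveDegree E v = 0) : clusterSum q w (remove v E) = clusterSum q w E := by
  refine clusterSum_congr q w fun i => ?_
  have hi : i ∉ (live E).filter fun i => (E i).1 = v ∨ (E i).2 = v := by
    rw [Finset.card_eq_zero.1 h]; simp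
  simp only [live, Finset.mem_filter, Finset.mem_univ, true_and] at hi
  simp only [remove]
  grind

theorem clusterSum_of_live_eq_empty [Finite V] (q w : ℂ) {E : ι → V × V} (h : live E = ∅) :
    clusterSum q w E = q ^ Nat.card V := by
  have e : comps E ∅ = Nat.card V := by
    refine Nat.card_congr
      { toFun := Quot.lift id fun x y ⟨i, hi, _⟩ => absurd hi (Finset.notMem_empty i)
        invFun := Quot.mk _
        left_inv := ?_
        right_inv := fun _ => rfl }
    rintro ⟨x⟩
    rfl
  simp [clusterSum, h, e]

/-! ### The ratios and their recursion -/

/-- The ratio by which the cluster sum changes when the edges at `v` are restored. -/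
noncomputable def ratio (q w : ℂ) (E : ι → V × V) (v : V) : ℂ :=
  clusterSum q w E / clusterSum q w (remove v E)

theorem ratio_of_liveDegree_eq_zero {q w : ℂ} {v : V} {E : ι → V × V} (h : liveDegree E v = 0)
    (h0 : clusterSum q w (remove v E) ≠ 0) : ratio q w E v = 1 := by
  rw [ratio, ← clusterSum_remove_of_liveDegree_eq_zero q w h, div_self]
  exact h0

/-- The weight of the contracted term in the recursion for the ratios. -/
noncomputable def contractWeight (q w : ℂ) (u v : V) (E : ι → V × V) : ℂ :=
  ((1 + w) ^ (between u v E).card - 1) / q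

/-- Removing `v` after `cut` gives the family without `v`, which is the denominator on the left.
Removing `v` after `merge` gives the sum without `u` and `v`; passing from this denominator to the
one without `v` alone costs the ratio at `u`. -/
theorem ratio_recursion [Finite V] {q w : ℂ} (hq : q ≠ 0) {u v : V} (huv : u ≠ v)
    (E : ι → V × V) (h0 : clusterSum q w (remove v E) ≠ 0)
    (h1 : clusterSum q w (remove u (remove v E)) ≠ 0) :
    ratio q w E v = ratio q w (cut u v E) v +
      contractWeight q w u v E * ratio q w (merge u v E) v / ratio q w (remove v E) u := by
  simp only [ratio]
  rw [remove_cut u v E huv, clusterSum_remove_merge q w huv, clusterSum_eq_cut_add_merge hq w huv E,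
    contractWeight]
  field_simp

/-! ### Bounds for the recursion -/

/-- The denominator 2^(Δ+1) keeps the bound below 1/2 as long as d ≤ Δ. Ratios that are divided by
always belong to vertices of such degree. -/
theorem norm_half_le {Δ d : ℕ} (hd : d ≤ Δ) {x : ℂ}
    (h : ‖x - 1‖ ≤ ((2 : ℝ) ^ d - 1) / 2 ^ (Δ + 1)) : 1 / 2 ≤ ‖x‖ := by
  have h1 : (2 : ℝ) ^ d ≤ 2 ^ Δ := pow_le_pow_right₀ (by norm_num) hd
  have h2 : ((2 : ℝ) ^ d - 1) / 2 ^ (Δ + 1) ≤ 1 / 2 := by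
    rw [div_le_div_iff₀ (by positivity) (by norm_num), pow_succ]
    linarith
  have h3 : ‖(1 : ℂ)‖ ≤ ‖x‖ + ‖x - 1‖ := by
    have := norm_sub_le x (x - 1)
    simpa using this
  rw [norm_one] at h3
  linarith

theorem norm_le_two_pow {Δ d : ℕ} {x : ℂ}
    (h : ‖x - 1‖ ≤ ((2 : ℝ) ^ d - 1) / 2 ^ (Δ + 1)) : ‖x‖ ≤ 2 ^ d := by
  have h1 : (1 : ℝ) ≤ 2 ^ d := one_le_pow₀ (by norm_num)
  have h2 : ((2 : ℝ) ^ d - 1) / 2 ^ (Δ + 1) ≤ 2 ^ d - 1 :=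
    div_le_self (by linarith) (one_le_pow₀ (by norm_num))
  have h3 := norm_add_le (x - 1) 1
  rw [sub_add_cancel, norm_one] at h3
  linarith

/-- The deletion term has degree at most d - 1 and uses up (2^d / 2 - 1) / 2^(Δ+1). The remaining
2^d / 2 of the numerator is left to the contraction term: there |x₂| ≤ 2^(d+Δ) and |x₃| ≥ 1/2, which
the smallness of `c` outweighs. -/
theorem norm_step_sub_one_le {Δ d d₁ d₂ d₃ : ℕ} {c x₁ x₂ x₃ : ℂ} (hd₁ : d₁ + 1 ≤ d)
    (hd₂ : d₂ ≤ d + Δ) (hd₃ : d₃ ≤ Δ) (hc : ‖c‖ * (32 * 16 ^ Δ) ≤ 1)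
    (h₁ : ‖x₁ - 1‖ ≤ ((2 : ℝ) ^ d₁ - 1) / 2 ^ (Δ + 1))
    (h₂ : ‖x₂ - 1‖ ≤ ((2 : ℝ) ^ d₂ - 1) / 2 ^ (Δ + 1))
    (h₃ : ‖x₃ - 1‖ ≤ ((2 : ℝ) ^ d₃ - 1) / 2 ^ (Δ + 1)) :
    ‖x₁ + c * x₂ / x₃ - 1‖ ≤ ((2 : ℝ) ^ d - 1) / 2 ^ (Δ + 1) := by
  have a₃ := norm_half_le hd₃ h₃
  have a₂ : ‖x₂‖ ≤ 2 ^ d * 2 ^ Δ := by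
    rw [← pow_add]
    exact (norm_le_two_pow h₂).trans (pow_le_pow_right₀ (by norm_num) hd₂)
  have a₁ : (2 : ℝ) ^ d₁ * 2 ≤ 2 ^ d := by
    rw [← pow_succ]; exact pow_le_pow_right₀ (by norm_num) hd₁
  have hD : (0 : ℝ) < 2 ^ d := by positivity
  have hF : (1 : ℝ) ≤ 2 ^ Δ := one_le_pow₀ (by norm_num)
  have h16 : (16 : ℝ) ^ Δ = 2 ^ Δ * 2 ^ Δ * (2 ^ Δ * 2 ^ Δ) := by
    rw [← mul_pow, ← mul_pow]; norm_num
  rw [pow_succ] at h₁ ⊢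
  rw [h16] at hc
  generalize (2 : ℝ) ^ Δ = F at *
  generalize (2 : ℝ) ^ d = D at *
  have hF0 : 0 < F := by linarith
  have a : ‖c * x₂ / x₃‖ ≤ D / (4 * F) := by
    rw [norm_div, norm_mul, div_le_iff₀ (by linarith)]
    calc ‖c‖ * ‖x₂‖ ≤ 1 / (32 * (F * F * (F * F))) * (D * F) := by
          refine mul_le_mul ?_ a₂ (norm_nonneg _) (by positivity)
          rwa [le_div_iff₀ (by positivity)]
      _ ≤ D / (8 * F) := by
          rw [div_mul_eq_mul_div, div_le_div_iff₀ (by positivity) (by positivity)]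
          have : 1 ≤ F * F := by nlinarith
          nlinarith [mul_pos hD (mul_pos hF0 hF0)]
      _ = D / (4 * F) * (1 / 2) := by ring
      _ ≤ D / (4 * F) * ‖x₃‖ := by gcongr
  calc ‖x₁ + c * x₂ / x₃ - 1‖ = ‖(x₁ - 1) + c * x₂ / x₃‖ := by ring_nf
    _ ≤ (2 ^ d₁ - 1) / (F * 2) + D / (4 * F) := (norm_add_le _ _).trans (add_le_add h₁ a)
    _ ≤ (D / 2 - 1) / (F * 2) + D / (4 * F) := by gcongr; linarith
    _ = (D - 1) / (F * 2) := by field_simp; ring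

/-- The weights 4^d make one step of the recursion a contraction with factor 1/2. The deletion term
gains 1/4 because its degree drops; the contraction term loses at most 4^Δ from the growth of the
degree and another 4^Δ from the error of the denominator, and the bound on `c` compensates for both.
-/
theorem norm_step_sub_step_le {Δ d d₁ d₂ d₃ k : ℕ} {c x₁ x₂ x₃ y₁ y₂ y₃ : ℂ} (hd₁ : d₁ + 1 ≤ d)
    (hd₂ : d₂ ≤ d + Δ) (hd₃ : d₃ ≤ Δ) (hc : ‖c‖ * (32 * 16 ^ Δ) ≤ 1)
    (hy₂ : ‖y₂ - 1‖ ≤ ((2 : ℝ) ^ d₂ - 1) / 2 ^ (Δ + 1))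
    (hy₃ : ‖y₃ - 1‖ ≤ ((2 : ℝ) ^ d₃ - 1) / 2 ^ (Δ + 1))
    (hx₃ : ‖x₃ - 1‖ ≤ ((2 : ℝ) ^ d₃ - 1) / 2 ^ (Δ + 1))
    (h₁ : ‖x₁ - y₁‖ ≤ 4 ^ d₁ / 2 ^ k) (h₂ : ‖x₂ - y₂‖ ≤ 4 ^ d₂ / 2 ^ k)
    (h₃ : ‖x₃ - y₃‖ ≤ 4 ^ d₃ / 2 ^ k) :
    ‖(x₁ + c * x₂ / x₃) - (y₁ + c * y₂ / y₃)‖ ≤ 4 ^ d / 2 ^ (k + 1) := by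
  have ax := norm_half_le hd₃ hx₃
  have ay := norm_half_le hd₃ hy₃
  have hx0 : x₃ ≠ 0 := by rw [← norm_pos_iff]; linarith
  have hy0 : y₃ ≠ 0 := by rw [← norm_pos_iff]; linarith
  have b₁ : (4 : ℝ) ^ d₁ ≤ 4 ^ d / 4 := by
    rw [le_div_iff₀ (by norm_num), ← pow_succ]; exact pow_le_pow_right₀ (by norm_num) hd₁
  have b₂ : (4 : ℝ) ^ d₂ ≤ 4 ^ d * 4 ^ Δ := by
    rw [← pow_add]; exact pow_le_pow_right₀ (by norm_num) hd₂
  have b₃ : (4 : ℝ) ^ d₃ ≤ 4 ^ Δ := pow_le_pow_right₀ (by norm_num) hd₃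
  have by₂ : ‖y₂‖ ≤ 4 ^ d * 4 ^ Δ :=
    (norm_le_two_pow hy₂).trans ((pow_le_pow_left₀ (by norm_num) (by norm_num) _).trans b₂)
  have hF : (1 : ℝ) ≤ 4 ^ Δ := one_le_pow₀ (by norm_num)
  have hD : (0 : ℝ) < 4 ^ d := by positivity
  have h16 : (16 : ℝ) ^ Δ = 4 ^ Δ * 4 ^ Δ := by rw [← mul_pow]; norm_num
  rw [h16] at hc
  have hk : (0 : ℝ) < 2 ^ k := by positivity
  replace h₁ := h₁.trans (div_le_div_of_nonneg_right b₁ hk.le)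
  replace h₂ := h₂.trans (div_le_div_of_nonneg_right b₂ hk.le)
  replace h₃ := h₃.trans (div_le_div_of_nonneg_right b₃ hk.le)
  rw [pow_succ]
  generalize (4 : ℝ) ^ Δ = F at *
  generalize (4 : ℝ) ^ d = D at *
  generalize (2 : ℝ) ^ k = T at *
  have hF0 : 0 < F := by linarith
  -- The difference of the quotients is split into the error of the numerator and the error of the
  -- denominator.
  have e : (x₁ + c * x₂ / x₃) - (y₁ + c * y₂ / y₃) =
      (x₁ - y₁) + c * ((x₂ - y₂) * x₃⁻¹ + y₂ * (y₃ - x₃) * (x₃⁻¹ * y₃⁻¹)) := by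
    field_simp; ring
  have ix : ‖x₃⁻¹‖ ≤ 2 := by
    rw [norm_inv]; exact (inv_anti₀ (by norm_num) ax).trans (by norm_num)
  have iy : ‖y₃⁻¹‖ ≤ 2 := by
    rw [norm_inv]; exact (inv_anti₀ (by norm_num) ay).trans (by norm_num)
  have hc' : ‖c‖ ≤ 1 / (32 * (F * F)) := by rwa [le_div_iff₀ (by positivity)]
  rw [norm_sub_rev] at h₃
  have s1 : ‖(x₂ - y₂) * x₃⁻¹‖ ≤ D * F / T * 2 := by
    rw [norm_mul]; exact mul_le_mul h₂ ix (norm_nonneg _) (by positivity)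
  have s2 : ‖y₂ * (y₃ - x₃) * (x₃⁻¹ * y₃⁻¹)‖ ≤ D * F * (F / T) * (2 * 2) := by
    rw [norm_mul, norm_mul, norm_mul]; gcongr
  have s3 : D * F / T * 2 ≤ D * F * (F / T) * 2 := by
    have : D * F / T ≤ D * F * (F / T) := by
      rw [← mul_div_assoc]; gcongr; exact le_mul_of_one_le_right (by positivity) hF
    linarith
  rw [e]
  calc _ ≤ ‖x₁ - y₁‖ + ‖c‖ * (‖(x₂ - y₂) * x₃⁻¹‖ + ‖y₂ * (y₃ - x₃) * (x₃⁻¹ * y₃⁻¹)‖) := by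
        refine (norm_add_le _ _).trans ?_
        rw [norm_mul]; gcongr; exact norm_add_le _ _
    _ ≤ D / 4 / T + 1 / (32 * (F * F)) * (D * F * (F / T) * 2 + D * F * (F / T) * (2 * 2)) := by
        gcongr; exact s1.trans s3
    -- The total factor is 1/4 + 6/32 = 7/16, below the required 1/2.
    _ = D / T * (1 / 4 + 6 / 32) := by field_simp; ring
    _ ≤ D / (T * 2) := by
        rw [← div_div, div_eq_mul_one_div (D / T) 2]
        gcongr; norm_num

/-- All vertices but `v` have at most `Δ` live edges. -/
def DegreeLEAwayFrom (Δ : ℕ) (E : ι → V × V) (v : V) : Prop := ∀ x ≠ v, liveDegree E x ≤ Δ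

theorem DegreeLEAwayFrom.cut {Δ : ℕ} {E : ι → V × V} {v : V} (h : DegreeLEAwayFrom Δ E v) (u : V) :
    DegreeLEAwayFrom Δ (cut u v E) v :=
  fun x hx => (liveDegree_cut_le _ _ _ _).trans (h x hx)

theorem DegreeLEAwayFrom.merge {Δ : ℕ} {E : ι → V × V} {v : V} (h : DegreeLEAwayFrom Δ E v)
    (u : V) : DegreeLEAwayFrom Δ (merge u v E) v :=
  fun x hx => (liveDegree_merge_le hx _).trans (h x hx)

theorem liveDegree_remove_self (v : V) (E : ι → V × V) : liveDegree (remove v E) v = 0 := by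
  rw [liveDegree, Finset.card_eq_zero, Finset.filter_eq_empty_iff]
  intro i
  simp only [live, remove]
  grind

/-- The vertex `v`, the only one whose degree may exceed Δ, becomes isolated. Afterwards every
vertex obeys the bound, and the exceptional role can pass to `u`. -/
theorem DegreeLEAwayFrom.remove {Δ : ℕ} {E : ι → V × V} {v : V} (h : DegreeLEAwayFrom Δ E v)
    (u : V) : DegreeLEAwayFrom Δ (remove v E) u := by
  intro x _
  rcases eq_or_ne x v with rfl | hx
  · rw [liveDegree_remove_self]; exact Nat.zero_le _
  · exact (liveDegree_remove_le _ _ _).trans (h x hx)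

/-- Nonvanishing and the estimate are proved together: the recursion needs nonzero denominators, and
a ratio of norm at least 1/2 has a nonzero numerator. All three families in the recursion have fewer
live edges, although the degree of `v` may grow under `merge`. -/
theorem ratio_bound [Finite V] {q w : ℂ} {Δ : ℕ} (hq : q ≠ 0)
    (hc : ∀ j ≤ Δ, ‖((1 + w) ^ j - 1) / q‖ * (32 * 16 ^ Δ) ≤ 1) (E : ι → V × V) (v : V)
    (hE : DegreeLEAwayFrom Δ E v) :
    clusterSum q w (remove v E) ≠ 0 ∧
      ‖ratio q w E v - 1‖ ≤ ((2 : ℝ) ^ liveDegree E v - 1) / 2 ^ (Δ + 1) := by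
  induction hN : (live E).card using Nat.strong_induction_on generalizing E v with
  | _ N ih =>
  subst hN
  -- The vertex is quantified anew because the case of an isolated `v` applies this statement to
  -- another vertex of the same family.
  have main : ∀ v, DegreeLEAwayFrom Δ E v → liveDegree E v ≠ 0 →
      clusterSum q w (remove v E) ≠ 0 ∧
      ‖ratio q w E v - 1‖ ≤ ((2 : ℝ) ^ liveDegree E v - 1) / 2 ^ (Δ + 1) := by
    intro v hE hv
    obtain ⟨u, hu⟩ := exists_between_of_liveDegree_ne_zero hv
    have huv := ne_of_between hu
    obtain ⟨-, b₁⟩ := ih _ (card_live_cut_lt hu) _ v (hE.cut u) rfl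
    obtain ⟨-, b₂⟩ := ih _ (card_live_merge_lt hu) _ v (hE.merge u) rfl
    obtain ⟨a₃, b₃⟩ := ih _ (card_live_remove_lt hu) _ u (hE.remove u) rfl
    have d₃ : liveDegree (remove v E) u ≤ Δ := (liveDegree_remove_le _ _ _).trans (hE u huv)
    have h0 : clusterSum q w (remove v E) ≠ 0 := by
      -- The sum without `v` is the numerator of the ratio at `u`, which has norm at least 1/2.
      intro h0
      have := norm_half_le d₃ b₃
      rw [ratio, h0, zero_div, norm_zero] at this
      linarith
    refine ⟨h0, ?_⟩
    rw [ratio_recursion hq huv E h0 a₃]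
    exact norm_step_sub_one_le (liveDegree_cut_lt hu)
      ((liveDegree_merge_self_le u v E).trans (Nat.add_le_add_left (hE u huv) _)) d₃
      (hc _ ((card_between_le u v E).trans (hE u huv))) b₁ b₂ b₃
  by_cases hv : liveDegree E v = 0
  -- If `v` is isolated, removing it changes nothing, so the full sum must be shown to be nonzero.
  -- It is a power of `q` if no live edge is left; otherwise it is the numerator of the ratio at an
  -- end of a live edge.
  · have h0 : clusterSum q w E ≠ 0 := by
      rcases (live E).eq_empty_or_nonempty with he | ⟨i, hi⟩
      · rw [clusterSum_of_live_eq_empty q w he]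
        exact pow_ne_zero _ hq
      · have hall : ∀ x, liveDegree E x ≤ Δ := fun x => by
          rcases eq_or_ne x v with rfl | hx
          · rw [hv]; exact Nat.zero_le _
          · exact hE x hx
        obtain ⟨a, b⟩ := main (E i).1 (fun x _ => hall x)
          (Finset.card_ne_zero.2 ⟨i, Finset.mem_filter.2 ⟨hi, Or.inl rfl⟩⟩)
        intro h0
        have := norm_half_le (hall _) b
        rw [ratio, h0, zero_div, norm_zero] at this
        linarith
    have h1 : clusterSum q w (remove v E) ≠ 0 := by
      rwa [clusterSum_remove_of_liveDegree_eq_zero q w hv]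
    exact ⟨h1, by simp [ratio_of_liveDegree_eq_zero hv h1, hv]⟩
  · exact main v hE hv

/-- The value obtained by unfolding the recursion for the ratio of `E` at `v` to depth `k`, with
arbitrary choices of the neighbours. -/
inductive IsApproxRatio (q w : ℂ) : ℕ → (ι → V × V) → V → ℂ → Prop
  | zero (E : ι → V × V) (v : V) : IsApproxRatio q w 0 E v 1
  | isolated (k : ℕ) (E : ι → V × V) (v : V) (h : liveDegree E v = 0) : IsApproxRatio q w k E v 1
  | step (k : ℕ) (E : ι → V × V) (u v : V) (x₁ x₂ x₃ : ℂ) (h : (between u v E).Nonempty)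
      (h₁ : IsApproxRatio q w k (cut u v E) v x₁) (h₂ : IsApproxRatio q w k (merge u v E) v x₂)
      (h₃ : IsApproxRatio q w k (remove v E) u x₃) :
      IsApproxRatio q w (k + 1) E v (x₁ + contractWeight q w u v E * x₂ / x₃)

/-- The approximations obey the same a priori bound as the true ratios, which keeps their
denominators away from 0 as well. The error is controlled level by level by `norm_step_sub_step_le`;
at depth 0 the value 1 is off by at most 2^d - 1. -/
theorem IsApproxRatio.bound [Finite V] {q w : ℂ} {Δ : ℕ} (hq : q ≠ 0)
    (hc : ∀ j ≤ Δ, ‖((1 + w) ^ j - 1) / q‖ * (32 * 16 ^ Δ) ≤ 1) {k : ℕ} {E : ι → V × V} {v : V}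
    {x : ℂ} (h : IsApproxRatio q w k E v x) (hE : DegreeLEAwayFrom Δ E v) :
    ‖x - 1‖ ≤ ((2 : ℝ) ^ liveDegree E v - 1) / 2 ^ (Δ + 1) ∧
      ‖x - ratio q w E v‖ ≤ 4 ^ liveDegree E v / 2 ^ k := by
  induction h with
  | zero E v =>
    have h1 : (1 : ℝ) ≤ 2 ^ liveDegree E v := one_le_pow₀ (by norm_num)
    refine ⟨by simpa using div_nonneg (by linarith) (by positivity), ?_⟩
    rw [norm_sub_rev]
    refine (ratio_bound hq hc E v hE).2.trans ?_
    have h2 : (2 : ℝ) ^ liveDegree E v ≤ 4 ^ liveDegree E v :=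
      pow_le_pow_left₀ (by norm_num) (by norm_num) _
    have h3 : ((2 : ℝ) ^ liveDegree E v - 1) / 2 ^ (Δ + 1) ≤ 2 ^ liveDegree E v - 1 :=
      div_le_self (by linarith) (one_le_pow₀ (by norm_num))
    rw [pow_zero, div_one]
    linarith
  | isolated k E v h =>
    rw [ratio_of_liveDegree_eq_zero h (ratio_bound hq hc E v hE).1, h]
    simp
  | step k E u v x₁ x₂ x₃ hu _ _ _ ih₁ ih₂ ih₃ =>
    have huv := ne_of_between hu
    obtain ⟨b₁, e₁⟩ := ih₁ (hE.cut u)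
    obtain ⟨b₂, e₂⟩ := ih₂ (hE.merge u)
    obtain ⟨b₃, e₃⟩ := ih₃ (hE.remove u)
    have d₂ := (liveDegree_merge_self_le u v E).trans (Nat.add_le_add_left (hE u huv) _)
    have d₃ : liveDegree (remove v E) u ≤ Δ := (liveDegree_remove_le _ _ _).trans (hE u huv)
    have c := hc _ ((card_between_le u v E).trans (hE u huv))
    refine ⟨norm_step_sub_one_le (liveDegree_cut_lt hu) d₂ d₃ c b₁ b₂ b₃, ?_⟩
    rw [ratio_recursion hq huv E (ratio_bound hq hc E v hE).1
      (ratio_bound hq hc _ u (hE.remove u)).1]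
    exact norm_step_sub_step_le (liveDegree_cut_lt hu) d₂ d₃ c
      (ratio_bound hq hc _ v (hE.merge u)).2 (ratio_bound hq hc _ u (hE.remove u)).2 b₃ e₁ e₂ e₃

end EdgeFamily

/-! ### Edge lists of multigraphs -/

namespace Graph.EdgeList

variable {α β : Type*} {G : Graph α β}

/-- The edge family of an edge list. -/
def ends (L : G.EdgeList) : Fin L.m → Fin L.n × Fin L.n := fun i => (L.fst i, L.snd i)

/-- The set of edges with the given numbers. -/
def edgeSetOf (L : G.EdgeList) (S : Finset (Fin L.m)) : Set β := (fun i => (L.edge i : β)) '' S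

theorem edge_injective (L : G.EdgeList) : Function.Injective fun i => (L.edge i : β) :=
  Subtype.val_injective.comp L.edge.injective

theorem numComponents_restrict (L : G.EdgeList) (S : Finset (Fin L.m)) :
    (G.restrict (L.edgeSetOf S)).numComponents = EdgeFamily.comps L.ends S := by
  rw [Graph.numComponents, EdgeFamily.comps]
  set r : V(G) → V(G) → Prop := fun x y => (G.restrict (L.edgeSetOf S)).Adj x.1 y.1 with hr
  set r' : Fin L.n → Fin L.n → Prop := fun x y => ∃ i ∈ S, L.ends i = (x, y) with hr'
  change Nat.card (Quot r) = Nat.card (Quot r')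
  have hr'v {x y} (i) (hi : i ∈ S) (e : L.ends i = (x, y)) : r (L.vert x) (L.vert y) := by
    refine ⟨L.edge i, ?_⟩
    rw [Graph.restrict_isLink]
    cases e
    exact ⟨⟨i, hi, rfl⟩, L.isLink i⟩
  refine Nat.card_congr
    { toFun := Quot.lift (fun x => Quot.mk r' (L.vert.symm x)) ?_
      invFun := Quot.lift (fun x => Quot.mk r (L.vert x)) ?_
      left_inv := ?_
      right_inv := ?_ }
  · rintro x y ⟨e, he⟩
    rw [Graph.restrict_isLink] at he
    obtain ⟨⟨i, hi, rfl⟩, he⟩ := he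
    have hl := L.isLink i
    have hs : Quot.mk r' (L.fst i) = Quot.mk r' (L.snd i) := Quot.sound ⟨i, hi, rfl⟩
    -- An edge of the multigraph is unordered, while the list orders its ends; the generated
    -- equivalence relation ignores the difference.
    rcases he.eq_and_eq_or_eq_and_eq hl with ⟨h1, h2⟩ | ⟨h1, h2⟩ <;>
      rw [Subtype.val_inj] at h1 h2 <;> subst h1 h2 <;> simp [hs]
  · rintro x y ⟨i, hi, e⟩
    exact Quot.sound (hr'v i hi e)
  · rintro ⟨x⟩
    exact congrArg (Quot.mk r) (L.vert.apply_symm_apply x)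
  · rintro ⟨x⟩
    exact congrArg (Quot.mk r') (L.vert.symm_apply_apply x)

/-- Encoding deleted edges as loops is harmless because the given multigraph has no loops of its
own. -/
theorem live_ends (L : G.EdgeList) (hG : G.Loopless) : EdgeFamily.live L.ends = Finset.univ := by
  refine Finset.filter_true_of_mem fun i _ h => ?_
  have := L.isLink i
  change L.fst i = L.snd i at h
  rw [h] at this
  exact hG.not_isLoopAt _ _ this

theorem tutte_eq_clusterSum (L : G.EdgeList) (hG : G.Loopless) (q w : ℂ) :
    G.tutte q w = EdgeFamily.clusterSum q w L.ends := by
  rw [Graph.tutte, EdgeFamily.clusterSum, L.live_ends hG, ← finsum_mem_coe_finset]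
  symm
  refine finsum_mem_eq_of_bijOn L.edgeSetOf ⟨?_, ?_, ?_⟩ ?_
  · rintro S -
    rintro _ ⟨i, -, rfl⟩
    exact (L.edge i).2
  · intro S _ S' _ h
    exact Finset.coe_injective (Set.image_injective.2 L.edge_injective h)
  · intro A hA
    classical
    refine ⟨Finset.univ.filter fun i => (L.edge i : β) ∈ A, by simp, ?_⟩
    ext e
    constructor
    · rintro ⟨i, hi, rfl⟩
      simpa using hi
    · intro he
      exact ⟨L.edge.symm ⟨e, hA he⟩, by simpa using he, by simp⟩
  · intro S _
    rw [L.numComponents_restrict, edgeSetOf, Set.ncard_image_of_injective _ L.edge_injective,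
      Set.ncard_coe_finset]

theorem liveDegree_ends_le (L : G.EdgeList) (v : Fin L.n) :
    EdgeFamily.liveDegree L.ends v ≤ G.degree (L.vert v) := by
  have : Finite E(G) := Finite.of_equiv _ L.edge
  rw [EdgeFamily.liveDegree, ← Set.ncard_coe_finset, Graph.degree,
    ← Set.ncard_image_of_injective _ L.edge_injective]
  refine le_add_right (Set.ncard_le_ncard ?_ ?_)
  · rintro _ ⟨i, hi, rfl⟩
    simp only [Finset.coe_filter, Set.mem_ofPred_eq] at hi
    rw [Graph.mem_incidenceSet]
    rcases hi.2 with e | e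
    · exact e ▸ (L.isLink i).inc_left
    · exact e ▸ (L.isLink i).inc_right
  · exact (Set.toFinite E(G)).subset fun e he => Graph.Inc.edge_mem he

theorem card_vertexSet (L : G.EdgeList) : V(G).ncard = L.n := by
  rw [← Nat.card_coe_set_eq, ← Nat.card_congr L.vert, Nat.card_eq_fintype_card, Fintype.card_fin]

/-- Each edge is charged to its first end, and a vertex is charged at most its degree. -/
theorem m_le (L : G.EdgeList) {Δ : ℕ} (hG : G.Loopless) (hΔ : ∀ v ∈ V(G), G.degree v ≤ Δ) :
    L.m ≤ L.n * Δ := by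
  have h := Finset.card_le_mul_card_image (f := L.fst) (Finset.univ : Finset (Fin L.m)) Δ ?_
  · rw [Finset.card_univ, Fintype.card_fin] at h
    refine h.trans ?_
    rw [mul_comm]
    refine Nat.mul_le_mul_right _ ((Finset.card_le_univ _).trans ?_)
    rw [Fintype.card_fin]
  · intro v _
    refine le_trans (Finset.card_le_card ?_)
      ((L.liveDegree_ends_le v).trans (hΔ _ (L.vert v).2))
    intro i hi
    rw [Finset.mem_filter] at hi
    rw [Finset.mem_filter, L.live_ends hG]
    exact ⟨Finset.mem_univ _, Or.inl hi.2⟩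

end Graph.EdgeList

/-! ### The cluster sum as a product of ratios -/

namespace EdgeFamily

variable {m n : ℕ}

/-- Turn the edges at the vertices below `i` into loops. -/
def dropBelow (i : ℕ) (E : Fin m → Fin n × Fin n) : Fin m → Fin n × Fin n :=
  fun e => if i ≤ (E e).1.val ∧ i ≤ (E e).2.val then E e else ((E e).1, (E e).1)

theorem dropBelow_zero (E : Fin m → Fin n × Fin n) : dropBelow 0 E = E := by
  funext e; simp [dropBelow]

theorem clusterSum_remove_dropBelow (q w : ℂ) (E : Fin m → Fin n × Fin n) (i : Fin n) :
    clusterSum q w (remove i (dropBelow i E)) = clusterSum q w (dropBelow (i + 1) E) := by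
  refine clusterSum_congr q w fun e => ?_
  simp only [remove, dropBelow, Fin.ext_iff]
  grind

theorem clusterSum_dropBelow_all (q w : ℂ) (E : Fin m → Fin n × Fin n) :
    clusterSum q w (dropBelow n E) = q ^ n := by
  rw [clusterSum_of_live_eq_empty, Nat.card_eq_fintype_card, Fintype.card_fin]
  refine Finset.filter_eq_empty_iff.2 fun e _ => ?_
  rw [dropBelow, if_neg (by have := (E e).1.2; omega)]
  simp

theorem liveDegree_dropBelow_le (i : ℕ) (E : Fin m → Fin n × Fin n) (x : Fin n) :
    liveDegree (dropBelow i E) x ≤ liveDegree E x := by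
  refine Finset.card_le_card fun e => ?_
  simp only [live, dropBelow, Finset.mem_filter, Finset.mem_univ, true_and]
  grind

/-- The product telescopes: deleting the edges at `i` after those at all smaller vertices passes
from `dropBelow i` to `dropBelow (i + 1)`. The last family has no live edges and contributes q^n. -/
theorem clusterSum_eq_prod_ratio {q w : ℂ} (E : Fin m → Fin n × Fin n)
    (h0 : ∀ i : Fin n, clusterSum q w (remove i (dropBelow i E)) ≠ 0) :
    clusterSum q w E = ∏ i : Fin n, q * ratio q w (dropBelow i E) i := by
  have key : ∀ k ≤ n, clusterSum q w E = (∏ i ∈ Finset.range k,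
      clusterSum q w (dropBelow i E) / clusterSum q w (dropBelow (i + 1) E)) *
        clusterSum q w (dropBelow k E) := by
    intro k
    induction k with
    | zero => simp [dropBelow_zero]
    | succ k ih =>
      intro hk
      have h := h0 ⟨k, hk⟩
      rw [clusterSum_remove_dropBelow] at h
      rw [ih (Nat.le_of_succ_le hk), Finset.prod_range_succ, mul_assoc, div_mul_cancel₀ _ h]
  rw [key n le_rfl, clusterSum_dropBelow_all, Finset.prod_mul_distrib, Finset.prod_const,
    Finset.card_univ, Fintype.card_fin, mul_comm, Finset.prod_range]
  congr 1
  refine Finset.prod_congr rfl fun i _ => ?_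
  rw [ratio, clusterSum_remove_dropBelow]

end EdgeFamily

/-- The real part of log(ξ/z) is the logarithm of the ratio of the moduli, and its imaginary part is
the angle up to sign. Near 1 the logarithm is at most 3/2 times the distance to 1. -/
theorem isMultApprox_of_norm_le {ε : ℝ} {z ξ : ℂ} (hz : z ≠ 0)
    (h : ‖ξ / z - 1‖ ≤ min ε 1 / 4) : IsMultApprox ε z ξ := by
  have h1 : ‖ξ / z - 1‖ ≤ 1 / 2 := by linarith [min_le_right ε 1]
  have hξ : ξ ≠ 0 := by
    rintro rfl
    norm_num at h1
  have hζ : ξ / z ≠ 0 := div_ne_zero hξ hz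
  have hl := Complex.norm_log_one_add_half_le_self h1
  rw [add_sub_cancel] at hl
  have hε : ‖Complex.log (ξ / z)‖ ≤ ε := by
    have := norm_nonneg (ξ / z - 1)
    linarith [min_le_left ε 1]
  have hre := (Complex.abs_re_le_norm _).trans hε
  have him := (Complex.abs_im_le_norm _).trans hε
  rw [Complex.log_im] at him
  rw [Complex.log_re, abs_le] at hre
  have hn : ‖z‖ / ‖ξ‖ = Real.exp (-Real.log ‖ξ / z‖) := by
    rw [Real.exp_neg, Real.exp_log (norm_pos_iff.2 hζ), norm_div, inv_div]
  refine ⟨hz, hξ, ?_, ?_, ?_⟩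
  · rw [hn]; exact Real.exp_le_exp.2 (by linarith)
  · rw [hn]; exact Real.exp_le_exp.2 (by linarith)
  · rwa [Complex.angle_eq_abs_arg hξ hz]

namespace EdgeFamily

/-- Each factor has relative error at most 2 · 4^Δ / 2^k, since the true ratio has norm at least
1/2. By the choice of `k` the sum S of these errors is at most min(ε, 1)/8, and the product is off
by at most e^S - 1 ≤ 2S. -/
theorem isMultApprox_prod {m n : ℕ} {q w : ℂ} {Δ k : ℕ} {ε : ℝ} (hq : q ≠ 0)
    (hc : ∀ j ≤ Δ, ‖((1 + w) ^ j - 1) / q‖ * (32 * 16 ^ Δ) ≤ 1) (E : Fin m → Fin n × Fin n)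
    (hE : ∀ v, liveDegree E v ≤ Δ) (x : Fin n → ℂ)
    (hx : ∀ i : Fin n, IsApproxRatio q w k (dropBelow i E) i (x i)) (hε : 0 < ε)
    (hk : 16 * 4 ^ Δ * n ≤ 2 ^ k * min ε 1) :
    IsMultApprox ε (clusterSum q w E) (∏ i, q * x i) := by
  have hd (i : Fin n) : DegreeLEAwayFrom Δ (dropBelow i E) i :=
    fun v _ => (liveDegree_dropBelow_le _ _ _).trans (hE v)
  have hd' (i : Fin n) : liveDegree (dropBelow i E) i ≤ Δ :=
    (liveDegree_dropBelow_le _ _ _).trans (hE i)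
  have hb (i : Fin n) := ratio_bound hq hc _ _ (hd i)
  have hr (i : Fin n) : 1 / 2 ≤ ‖ratio q w (dropBelow i E) i‖ := norm_half_le (hd' i) (hb i).2
  have hr0 (i : Fin n) : ratio q w (dropBelow i E) i ≠ 0 := by
    rw [← norm_pos_iff]; linarith [hr i]
  rw [clusterSum_eq_prod_ratio E fun i => (hb i).1]
  have hε' : 0 < min ε 1 := lt_min hε one_pos
  refine isMultApprox_of_norm_le (Finset.prod_ne_zero_iff.2 fun i _ => mul_ne_zero hq (hr0 i)) ?_
  have hy (i : Fin n) :
      ‖x i / ratio q w (dropBelow i E) i - 1‖ ≤ 2 * 4 ^ Δ / 2 ^ k := by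
    rw [div_sub_one (hr0 i), norm_div, div_le_iff₀ (by linarith [hr i])]
    have h1 : (4 : ℝ) ^ liveDegree (dropBelow i E) i ≤ 4 ^ Δ :=
      pow_le_pow_right₀ (by norm_num) (hd' i)
    calc _ ≤ (4 : ℝ) ^ liveDegree (dropBelow i E) i / 2 ^ k := ((hx i).bound hq hc (hd i)).2
      _ ≤ 4 ^ Δ / 2 ^ k := by gcongr
      _ = 2 * 4 ^ Δ / 2 ^ k * (1 / 2) := by ring
      _ ≤ _ := by gcongr; exact hr i
  have e : (∏ i, q * x i) / ∏ i : Fin n, q * ratio q w (dropBelow i E) i =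
      ∏ i : Fin n, (1 + (x i / ratio q w (dropBelow i E) i - 1)) := by
    rw [← Finset.prod_div_distrib]
    refine Finset.prod_congr rfl fun i _ => ?_
    rw [add_sub_cancel, mul_div_mul_left _ _ hq]
  rw [e]
  refine (Finset.norm_prod_one_add_sub_one_le _ _).trans ?_
  set S := ∑ i : Fin n, ‖x i / ratio q w (dropBelow i E) i - 1‖ with hS
  have hS0 : 0 ≤ S := Finset.sum_nonneg fun _ _ => norm_nonneg _
  have hS1 : S ≤ min ε 1 / 8 := by
    calc S ≤ ∑ _i : Fin n, 2 * 4 ^ Δ / 2 ^ k := Finset.sum_le_sum fun i _ => hy i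
      _ = 2 * 4 ^ Δ * n / 2 ^ k := by
        rw [Finset.sum_const, Finset.card_univ, Fintype.card_fin, nsmul_eq_mul]; ring
      _ ≤ min ε 1 / 8 := by
        rw [div_le_div_iff₀ (by positivity) (by norm_num)]
        linarith
  have := Real.abs_exp_sub_one_le (x := S)
    (by rw [abs_of_nonneg hS0]; linarith [min_le_right ε 1])
  rw [abs_of_nonneg hS0] at this
  linarith [le_abs_self (Real.exp S - 1)]

end EdgeFamily

/-! ### Total correctness of programs with time bounds -/

namespace ComplexRAM

@[simp] theorem State.setNat_nat (s : State) (x i v y j : ℕ) :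
    (s.setNat x i v).nat y j = if y = x ∧ j = i then v else s.nat y j := by
  simp only [State.setNat, Function.update_apply]
  split_ifs <;> simp_all

@[simp] theorem State.setNat_num (s : State) (x i v : ℕ) : (s.setNat x i v).num = s.num := rfl

@[simp] theorem State.setNum_num (s : State) (x i : ℕ) (v : ℂ) (y j : ℕ) :
    (s.setNum x i v).num y j = if y = x ∧ j = i then v else s.num y j := by
  simp only [State.setNum, Function.update_apply]
  split_ifs <;> simp_all

@[simp] theorem State.setNum_nat (s : State) (x i : ℕ) (v : ℂ) : (s.setNum x i v).nat = s.nat := rfl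

/-- Started in `s`, the program halts within `T` steps in a memory configuration satisfying `Q`. -/
def Runs (p : Program) (s : State) (T : ℕ) (Q : State → Prop) : Prop :=
  ∃ s' t, Exec p s s' t ∧ t ≤ T ∧ Q s'

theorem Runs.mono {p : Program} {s : State} {T T' : ℕ} {Q Q' : State → Prop} (h : Runs p s T Q)
    (hT : T ≤ T') (hQ : ∀ s', Q s' → Q' s') : Runs p s T' Q' := by
  obtain ⟨s', t, h1, h2, h3⟩ := h
  exact ⟨s', t, h1, h2.trans hT, hQ s' h3⟩

theorem Runs.seq {p p' : Program} {s : State} {T T' : ℕ} {Q Q' : State → Prop} (h : Runs p s T Q)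
    (h' : ∀ s', Q s' → Runs p' s' T' Q') : Runs (.seq p p') s (T + T') Q' := by
  obtain ⟨s', t, h1, h2, h3⟩ := h
  obtain ⟨s'', t', h1', h2', h3'⟩ := h' s' h3
  exact ⟨s'', t + t', .seq h1 h1', add_le_add h2 h2', h3'⟩

theorem Runs.branch {b : Test} {p p' : Program} {s : State} {T : ℕ} {Q : State → Prop}
    (h : b.Holds s → Runs p s T Q) (h' : ¬ b.Holds s → Runs p' s T Q) :
    Runs (.branch b p p') s (b.cost + T) Q := by
  by_cases hb : b.Holds s
  · obtain ⟨s', t, h1, h2, h3⟩ := h hb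
    exact ⟨s', _, .branch_true hb h1, Nat.add_le_add_left h2 _, h3⟩
  · obtain ⟨s', t, h1, h2, h3⟩ := h' hb
    exact ⟨s', _, .branch_false hb h1, Nat.add_le_add_left h2 _, h3⟩

/-- A loop with an invariant indexed by a bound for the number of remaining iterations. -/
theorem Runs.loop {b : Test} {p : Program} {T : ℕ} (Inv : ℕ → State → Prop)
    (hstep : ∀ N s, Inv N s → b.Holds s → Runs p s T fun s' => ∃ N' < N, Inv N' s')
    {N : ℕ} {s : State} (h : Inv N s) :
    Runs (.loop b p) s (N * (b.cost + T) + b.cost)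
      fun s' => (∃ N', Inv N' s') ∧ ¬ b.Holds s' := by
  induction N using Nat.strong_induction_on generalizing s with
  | _ N ih =>
    by_cases hb : b.Holds s
    · obtain ⟨s', t, h1, h2, N', hN, h3⟩ := hstep N s h hb
      obtain ⟨s'', t', h1', h2', h3'⟩ := ih N' hN h3
      refine ⟨s'', _, .loop_true hb h1 h1', ?_, h3'⟩
      have := Nat.mul_le_mul_right (b.cost + T) (Nat.succ_le_of_lt hN)
      rw [Nat.succ_mul] at this
      omega
    · exact ⟨s, _, .loop_false hb, Nat.le_add_left _ _, ⟨N, h⟩, hb⟩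

/-- A loop with a fixed number of iterations. -/
theorem Runs.loopUpTo {b : Test} {p : Program} {T : ℕ} (N : ℕ) (Inv : ℕ → State → Prop)
    (hb : ∀ j ≤ N, ∀ s, Inv j s → (b.Holds s ↔ j < N))
    (hstep : ∀ j < N, ∀ s, Inv j s → Runs p s T (Inv (j + 1))) {s : State} (h : Inv 0 s) :
    Runs (.loop b p) s (N * (b.cost + T) + b.cost) (Inv N) := by
  have := Runs.loop (b := b) (p := p) (T := T)
    (fun R s => ∃ j, R + j = N ∧ Inv j s) ?_ (N := N) ⟨0, rfl, h⟩
  · refine this.mono le_rfl ?_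
    rintro s' ⟨⟨R, j, hj, hI⟩, hn⟩
    rw [hb j (by omega) s' hI] at hn
    obtain rfl : j = N := by omega
    exact hI
  · rintro R s ⟨j, hj, hI⟩ hs
    have hlt := (hb j (by omega) s hI).1 hs
    exact (hstep j hlt s hI).mono le_rfl fun s' h' => ⟨R - 1, by omega, j + 1, by omega, h'⟩

/-- Programs without loops. -/
def Program.Straight : Program → Prop
  | .seq p p' => p.Straight ∧ p'.Straight
  | .branch _ p p' => p.Straight ∧ p'.Straight
  | .loop _ _ => False
  | _ => True

/-- A bound for the running time of a program without loops. -/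
def Program.bound : Program → ℕ
  | .skip => 1
  | .setNat _ i e => i.cost + e.cost + 1
  | .setNum _ i e => i.cost + e.cost + 1
  | .seq p p' => p.bound + p'.bound
  | .branch b p p' => b.cost + (p.bound + p'.bound)
  | .loop _ _ => 0

open scoped Classical in
/-- The effect of a program without loops. -/
noncomputable def Program.run : Program → State → State
  | .skip, s => s
  | .setNat x i e, s => s.setNat x (i.eval s) (e.eval s)
  | .setNum x i e, s => s.setNum x (i.eval s) (e.eval s)
  | .seq p p', s => p'.run (p.run s)
  | .branch b p p', s => if b.Holds s then p.run s else p'.run s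
  | .loop _ _, s => s

/-- Without loops the final memory is an explicit function of the initial one, so that the
verification of a loop body reduces to computing `Program.run`. For a branch, `Program.bound` adds
up both alternatives, which avoids a maximum. -/
theorem Program.Straight.runs {p : Program} (hp : p.Straight) (s : State) :
    Runs p s p.bound (· = p.run s) := by
  induction p generalizing s with
  | skip => exact ⟨_, _, .skip s, le_rfl, rfl⟩
  | setNat => exact ⟨_, _, .setNat _ _ _ _, le_rfl, rfl⟩
  | setNum => exact ⟨_, _, .setNum _ _ _ _, le_rfl, rfl⟩
  | seq p p' ih ih' =>
    refine (ih hp.1 s).seq fun s' h => ?_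
    subst h
    exact ih' hp.2 _
  | branch b p p' ih ih' =>
    refine Runs.branch (fun h => ?_) fun h => ?_
    · exact (ih hp.1 s).mono (Nat.le_add_right _ _) fun s' h' => by rw [h', Program.run, if_pos h]
    · exact (ih' hp.2 s).mono (Nat.le_add_left _ _) fun s' h' => by rw [h', Program.run, if_neg h]
  | loop => exact hp.elim

theorem Program.Straight.runs_of {p : Program} (hp : p.Straight) {s : State} {Q : State → Prop}
    (h : Q (p.run s)) : Runs p s p.bound Q :=
  (hp.runs s).mono le_rfl fun _ e => e ▸ h

/-- The entry `0` of an array of natural numbers. -/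
def scalar (x : ℕ) : NatExp := .get x (.const 0)

/-- Assignment to the entry `0` of an array of natural numbers. -/
def setScalar (x : ℕ) (e : NatExp) : Program := .setNat x (.const 0) e

/-- The entry `0` of an array of complex numbers. -/
def numScalar (x : ℕ) : NumExp := .get x (.const 0)

/-- Assignment to the entry `0` of an array of complex numbers. -/
def setNumScalar (x : ℕ) (e : NumExp) : Program := .setNum x (.const 0) e

/-- The test `a = b` for natural numbers. -/
def eqTest (a b : NatExp) : Test := .natLe (.add (.sub a b) (.sub b a)) (.const 0)

/-- The test `a < b` for natural numbers. -/
def ltTest (a b : NatExp) : Test := .natLe (.add a (.const 1)) b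

@[simp] theorem scalar_eval (s : State) (x : ℕ) : (scalar x).eval s = s.nat x 0 := rfl

@[simp] theorem numScalar_eval (s : State) (x : ℕ) : (numScalar x).eval s = s.num x 0 := rfl

@[simp] theorem holds_eqTest (s : State) (a b : NatExp) :
    (eqTest a b).Holds s ↔ a.eval s = b.eval s := by
  simp only [eqTest, Test.Holds, NatExp.eval]; omega

@[simp] theorem holds_ltTest (s : State) (a b : NatExp) :
    (ltTest a b).Holds s ↔ a.eval s < b.eval s := by
  simp only [ltTest, Test.Holds, NatExp.eval]; omega

end ComplexRAM

/-! ### The algorithm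

The program grows a forest whose nodes are triples of a depth `k`, a vertex `v` and an edge family
`E`, beginning with one root for each vertex of the graph, and later evaluates the recursion for
the ratios from the leaves to the roots. The arrays of natural numbers are used as follows.

* `10`, `11`: the ends of the edges of the nodes, the `j`-th edge of the `i`-th node being stored at
  `i * m + j`
* `12`, `13`: depths and vertices of the nodes
* `14`: the index of the first of the three children of a node, or `0`
* `20`: the depth of the roots
* `21`, `22`: index and edge address of the node that is being processed
* `23`, `24`: index and edge address of the next free node
* `25`: loop counter
* `26`, `31`: the neighbour `u` and the vertex `v` of the node that is being processed
* `28`, `29`, `32`, `33`, `34`, `35`, `36`: temporary values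

The array `4` of complex numbers holds the weights of the contracted terms, the array `5` the
values of the nodes, and the array `6` a temporary value. -/

namespace ComplexRAM

open EdgeFamily

/-- Sequential composition of a list of programs. -/
def block : List Program → Program
  | [] => .skip
  | p :: ps => .seq p (block ps)

/-- Increase a scalar by one. -/
def increment (x : ℕ) : Program := setScalar x (.add (scalar x) (.const 1))

/-- The first end of the current edge of the node that is being processed. -/
def headFst : NatExp := .get 10 (.add (scalar 22) (scalar 25))

/-- The second end of the current edge of the node that is being processed. -/
def headSnd : NatExp := .get 11 (.add (scalar 22) (scalar 25))

def scanBody : Program := block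
  [ .branch (eqTest headFst (scalar 31))
      (.branch (eqTest headSnd (scalar 31)) .skip (setScalar 26 headSnd))
      (.branch (eqTest headSnd (scalar 31)) (setScalar 26 headFst) .skip),
    increment 25 ]

/-- Search a neighbour of the vertex in scalar `31`. -/
def scanLoop : Program := .loop (ltTest (scalar 25) (scalar 1)) scanBody

/-- Set the scalar `y` to the scalar `c` if the scalars `a` and `b` are equal, and to the scalar `d`
otherwise. -/
def select (y a b c d : ℕ) : Program :=
  .seq (setScalar y (scalar d)) (.branch (eqTest (scalar a) (scalar b)) (setScalar y (scalar c)) .skip)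

/-- Compute the ends of the current edge in the three children. -/
def childEnds : Program := block
  [ setScalar 32 headFst, setScalar 33 headSnd, select 28 32 26 31 32, select 29 33 26 31 33,
    select 34 28 29 32 33, select 35 33 31 32 33, select 36 32 31 32 35 ]

/-- Multiply by `1 + w` if the current edge is a live edge between `u` and `v`. -/
def countEdge : Program :=
  .branch (eqTest (scalar 28) (scalar 29))
    (.branch (eqTest (scalar 32) (scalar 33)) .skip
      (setNumScalar 6 (.mul (numScalar 6) (.add (.ofNat (.const 1)) (numScalar 1))))) .skip

/-- The address of the current edge in the first free node. -/
def tailAddr : NatExp := .add (scalar 24) (scalar 25)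

/-- Store the ends of the current edge in the three children. -/
def storeEnds : Program := block
  [ .setNat 10 tailAddr (scalar 32), .setNat 11 tailAddr (scalar 34),
    .setNat 10 (.add tailAddr (scalar 1)) (scalar 28),
    .setNat 11 (.add tailAddr (scalar 1)) (scalar 29),
    .setNat 10 (.add (.add tailAddr (scalar 1)) (scalar 1)) (scalar 32),
    .setNat 11 (.add (.add tailAddr (scalar 1)) (scalar 1)) (scalar 36),
    increment 25 ]

def childBody : Program := .seq childEnds (.seq countEdge storeEnds)

/-- Write the edges of the three children of a node. -/
def childLoop : Program := .loop (ltTest (scalar 25) (scalar 1)) childBody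

/-! ### Scanning the edges of a node and writing those of its children -/

/-- `E` is stored from the address `a` on. -/
def HoldsEdges {m n : ℕ} (s : State) (a : ℕ) (E : Fin m → Fin n × Fin n) : Prop :=
  ∀ i : Fin m, s.nat 10 (a + i) = (E i).1 ∧ s.nat 11 (a + i) = (E i).2

/-- All arrays of natural numbers but those listed agree. -/
def AgreeOff (l : List ℕ) (s s' : State) : Prop := ∀ x ∉ l, ∀ i, s'.nat x i = s.nat x i

theorem runs_scanLoop {m n : ℕ} {s : State} {E : Fin m → Fin n × Fin n} {v : Fin n}
    (hm : s.nat 1 0 = m) (hE : HoldsEdges s (s.nat 22 0) E) (hv : s.nat 31 0 = v)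
    (hj : s.nat 25 0 = 0) (hu : s.nat 26 0 = v) :
    Runs scanLoop s (m * ((ltTest (scalar 25) (scalar 1)).cost + scanBody.bound) +
        (ltTest (scalar 25) (scalar 1)).cost)
      fun s' => AgreeOff [25, 26] s s' ∧ s'.num = s.num ∧
        (s'.nat 26 0 = v ∧ liveDegree E v = 0 ∨
          ∃ u : Fin n, s'.nat 26 0 = u ∧ (between u v E).Nonempty) := by
  -- Scalar `26` starts as `v` itself, which signals that no neighbour has been found; a neighbour
  -- joined by a live edge is always different from `v`. If several neighbours exist, the last one
  -- found is kept.
  let Inv : ℕ → State → Prop := fun j s' => AgreeOff [25, 26] s s' ∧ s'.num = s.num ∧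
    s'.nat 25 0 = j ∧
    (s'.nat 26 0 = v ∧ (∀ i : Fin m, i.val < j →
        ¬ ((E i).1 ≠ (E i).2 ∧ ((E i).1 = v ∨ (E i).2 = v))) ∨
      ∃ u : Fin n, s'.nat 26 0 = u ∧ (between u v E).Nonempty)
  refine (Runs.loopUpTo m Inv ?_ ?_ ?_).mono le_rfl ?_
  · rintro j - s' ⟨hf, -, h25, -⟩
    rw [holds_ltTest, scalar_eval, scalar_eval, h25, hf 1 (by decide), hm]
  · rintro j hj s' ⟨hf, hn, h25, hd⟩
    refine Program.Straight.runs_of (by simp [scanBody, block, Program.Straight, setScalar, increment]) ?_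
    obtain ⟨e1, e2⟩ := hE ⟨j, hj⟩
    have g1 : s'.nat 10 (s'.nat 22 0 + j) = (E ⟨j, hj⟩).1 := by
      rw [hf 10 (by decide), hf 22 (by decide), ← e1]
    have g2 : s'.nat 11 (s'.nat 22 0 + j) = (E ⟨j, hj⟩).2 := by
      rw [hf 11 (by decide), hf 22 (by decide), ← e2]
    have g3 : s'.nat 31 0 = v := by rw [hf 31 (by decide), hv]
    have hmem (u : Fin n) (hne : (E ⟨j, hj⟩).1 ≠ (E ⟨j, hj⟩).2)
        (h : E ⟨j, hj⟩ = (u, v) ∨ E ⟨j, hj⟩ = (v, u)) : (between u v E).Nonempty := by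
      refine ⟨⟨j, hj⟩, ?_⟩
      simp only [between, live, relabel]
      rcases h with h | h <;> simp_all
    have hlast (h : ¬ ((E ⟨j, hj⟩).1 ≠ (E ⟨j, hj⟩).2 ∧
        ((E ⟨j, hj⟩).1 = v ∨ (E ⟨j, hj⟩).2 = v))) :
        (s'.nat 26 0 = v ∧ (∀ i : Fin m, i.val < j + 1 →
          ¬ ((E i).1 ≠ (E i).2 ∧ ((E i).1 = v ∨ (E i).2 = v))) ∨
        ∃ u : Fin n, s'.nat 26 0 = u ∧ (between u v E).Nonempty) := by
      rcases hd with ⟨h1, h2⟩ | h1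
      · refine Or.inl ⟨h1, fun i hi => ?_⟩
        rcases Nat.lt_succ_iff_lt_or_eq.1 hi with hi | hi
        · exact h2 i hi
        · have : i = ⟨j, hj⟩ := Fin.ext hi
          rwa [this]
      · exact Or.inr h1
    have hkeep (h : ¬ ((E ⟨j, hj⟩).1 ≠ (E ⟨j, hj⟩).2 ∧
        ((E ⟨j, hj⟩).1 = v ∨ (E ⟨j, hj⟩).2 = v)))
        (hr : scanBody.run s' = s'.setNat 25 0 (j + 1)) : Inv (j + 1) (scanBody.run s') := by
      rw [hr]
      refine ⟨fun x hx i => ?_, hn, by simp, by simpa using hlast h⟩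
      have hx' := hx
      simp only [List.mem_cons, List.not_mem_nil, or_false, not_or] at hx'
      simp [hx', hf x hx]
    have hfound (u : Fin n) (hne : (E ⟨j, hj⟩).1 ≠ (E ⟨j, hj⟩).2)
        (h : E ⟨j, hj⟩ = (u, v) ∨ E ⟨j, hj⟩ = (v, u))
        (hr : scanBody.run s' = (s'.setNat 26 0 u).setNat 25 0 (j + 1)) :
        Inv (j + 1) (scanBody.run s') := by
      rw [hr]
      refine ⟨fun x hx i => ?_, hn, by simp, Or.inr ⟨u, by simp, hmem u hne h⟩⟩
      have hx' := hx
      simp only [List.mem_cons, List.not_mem_nil, or_false, not_or] at hx'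
      simp [hx', hf x hx]
    by_cases c1 : (E ⟨j, hj⟩).1 = v <;> by_cases c2 : (E ⟨j, hj⟩).2 = v
    · refine hkeep (by simp [c1, c2]) ?_
      simp [scanBody, block, Program.run, headFst, headSnd, NatExp.eval, g1, g2, g3, h25, c1, c2,
        increment, setScalar]
    · refine hfound (E ⟨j, hj⟩).2 (by rw [c1]; exact Ne.symm c2) (Or.inr (by rw [← c1])) ?_
      simp [scanBody, block, Program.run, headFst, headSnd, NatExp.eval, g1, g2, g3, h25, c1,
        Fin.val_inj, c2, increment, setScalar]
    · refine hfound (E ⟨j, hj⟩).1 (by rw [c2]; exact c1) (Or.inl (by rw [← c2])) ?_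
      simp [scanBody, block, Program.run, headFst, headSnd, NatExp.eval, g1, g2, g3, h25, c1,
        Fin.val_inj, c2, increment, setScalar]
    · refine hkeep (by simp [c1, c2]) ?_
      simp [scanBody, block, Program.run, headFst, headSnd, NatExp.eval, g1, g2, g3, h25, c1, c2,
        Fin.val_inj, increment, setScalar]
  · refine ⟨fun _ _ _ => rfl, rfl, hj, Or.inl ⟨hu, fun i hi => absurd hi (Nat.not_lt_zero _)⟩⟩
  · rintro s' ⟨hf, hn, -, hd⟩
    refine ⟨hf, hn, hd.imp_left fun ⟨h1, h2⟩ => ⟨h1, ?_⟩⟩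
    rw [liveDegree, Finset.card_eq_zero, Finset.filter_eq_empty_iff]
    intro i hi h
    exact h2 i i.2 ⟨(Finset.mem_filter.1 hi).2, h⟩

/-- The target is first overwritten by the default value, so it must differ from the scalars that
are read afterwards. -/
theorem run_select (s : State) {y a b c d : ℕ} (ha : a ≠ y) (hb : b ≠ y) (hc : c ≠ y) :
    (select y a b c d).run s =
      s.setNat y 0 (if s.nat a 0 = s.nat b 0 then s.nat c 0 else s.nat d 0) := by
  simp only [select, Program.run, setScalar, NatExp.eval, scalar_eval, holds_eqTest,
    State.setNat_nat, ha, hb, hc, false_and, if_false]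
  split_ifs
  · simp [State.setNat]
  · rfl

/-- Deleting an edge moves its second end to the first. Hence only the second ends, in scalars `34`
and `36`, have to be computed for `cut` and `remove`, while `merge` changes both ends. -/
theorem run_childEnds {m n : ℕ} {s : State} {E : Fin m → Fin n × Fin n} {u v : Fin n} (j : Fin m)
    (h10 : s.nat 10 (s.nat 22 0 + s.nat 25 0) = (E j).1)
    (h11 : s.nat 11 (s.nat 22 0 + s.nat 25 0) = (E j).2) (hu : s.nat 26 0 = u)
    (hv : s.nat 31 0 = v) :
    AgreeOff [28, 29, 32, 33, 34, 35, 36] s (childEnds.run s) ∧ (childEnds.run s).num = s.num ∧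
      (childEnds.run s).nat 32 0 = (E j).1 ∧ (childEnds.run s).nat 33 0 = (E j).2 ∧
      (childEnds.run s).nat 28 0 = (merge u v E j).1 ∧
      (childEnds.run s).nat 29 0 = (merge u v E j).2 ∧
      (childEnds.run s).nat 34 0 = (cut u v E j).2 ∧
      (childEnds.run s).nat 36 0 = (remove v E j).2 := by
  have h28 : (childEnds.run s).nat 28 0 = (merge u v E j).1 := by
    simp [childEnds, block, Program.run, run_select, setScalar, NatExp.eval, headFst, headSnd, h10,
      h11, hu, hv, merge, relabel, Fin.val_inj]
    split_ifs <;> rfl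
  have h29 : (childEnds.run s).nat 29 0 = (merge u v E j).2 := by
    simp [childEnds, block, Program.run, run_select, setScalar, NatExp.eval, headFst, headSnd, h10,
      h11, hu, hv, merge, relabel, Fin.val_inj]
    split_ifs <;> rfl
  refine ⟨fun x hx i => ?_, ?_, ?_, ?_, h28, h29, ?_, ?_⟩
  · simp only [List.mem_cons, List.not_mem_nil, or_false, not_or] at hx
    simp [childEnds, block, Program.run, run_select, setScalar, hx]
  · simp [childEnds, block, Program.run, run_select, setScalar]
  · simp [childEnds, block, Program.run, run_select, setScalar, NatExp.eval, headFst, h10]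
  · simp [childEnds, block, Program.run, run_select, setScalar, NatExp.eval, headSnd, h11]
  · have : (childEnds.run s).nat 34 0 = if (childEnds.run s).nat 28 0 = (childEnds.run s).nat 29 0
        then ((E j).1 : ℕ) else (E j).2 := by
      simp [childEnds, block, Program.run, run_select, setScalar, NatExp.eval, headFst, headSnd,
        h10, h11]
    rw [this, h28, h29, cut]
    simp only [merge, Fin.val_inj]
    split_ifs <;> rfl
  · simp [childEnds, block, Program.run, run_select, setScalar, NatExp.eval, headFst, headSnd,
      h10, h11, hv, Fin.val_inj, remove]
    split_ifs <;> simp_all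

theorem run_countEdge {m n : ℕ} {s : State} {E : Fin m → Fin n × Fin n} {u v : Fin n} (j : Fin m)
    (h32 : s.nat 32 0 = (E j).1) (h33 : s.nat 33 0 = (E j).2)
    (h28 : s.nat 28 0 = (merge u v E j).1) (h29 : s.nat 29 0 = (merge u v E j).2) :
    (countEdge.run s).nat = s.nat ∧ (∀ x i, x ≠ 6 → (countEdge.run s).num x i = s.num x i) ∧
      (countEdge.run s).num 6 0 =
        s.num 6 0 * (1 + s.num 1 0) ^ (if j ∈ between u v E then 1 else 0) := by
  have hj : j ∈ between u v E ↔
      (merge u v E j).1 = (merge u v E j).2 ∧ ¬ (E j).1 = (E j).2 := by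
    simp [between, live, merge, and_comm]
  by_cases h1 : (merge u v E j).1 = (merge u v E j).2 <;> by_cases h2 : (E j).1 = (E j).2 <;>
    simp +contextual [countEdge, Program.run, h28, h29, h32, h33, Fin.val_inj, h1, h2, hj,
      setNumScalar, NumExp.eval, NatExp.eval]

theorem card_filter_lt_succ {m : ℕ} (P : Finset (Fin m)) (j : Fin m) :
    (P.filter fun i => i.val < j.val + 1).card =
      (P.filter fun i => i.val < j.val).card + if j ∈ P then 1 else 0 := by
  split_ifs with h
  · rw [← Finset.card_insert_of_notMem (a := j) (by simp)]
    congr 1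
    ext i
    simp only [Finset.mem_filter, Finset.mem_insert, Fin.ext_iff]
    constructor
    · rintro ⟨h1, h2⟩; by_cases e : i.val = j.val <;> simp [*]; omega
    · rintro (h1 | ⟨h1, h2⟩)
      · rw [← Fin.ext_iff] at h1; subst h1; simp [h]
      · exact ⟨h1, by omega⟩
  · congr 1
    ext i
    simp only [Finset.mem_filter, and_congr_right_iff]
    intro hi
    have : i.val ≠ j.val := fun e => h (Fin.ext e ▸ hi)
    omega

/-- `childLoop` writes the edges of the three children to the first three free nodes. -/
theorem runs_childLoop {m n : ℕ} {s : State} {E : Fin m → Fin n × Fin n} {u v : Fin n}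
    (hm : s.nat 1 0 = m) (hE : HoldsEdges s (s.nat 22 0) E)
    (ht : s.nat 22 0 + m ≤ s.nat 24 0) (hu : s.nat 26 0 = u) (hv : s.nat 31 0 = v)
    (hj : s.nat 25 0 = 0) (h6 : s.num 6 0 = 1) :
    Runs childLoop s (m * ((ltTest (scalar 25) (scalar 1)).cost + childBody.bound) +
        (ltTest (scalar 25) (scalar 1)).cost)
      fun s' => AgreeOff [10, 11, 25, 28, 29, 32, 33, 34, 35, 36] s s' ∧
        (∀ i < s.nat 24 0, s'.nat 10 i = s.nat 10 i ∧ s'.nat 11 i = s.nat 11 i) ∧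
        (∀ x i, x ≠ 6 → s'.num x i = s.num x i) ∧
        HoldsEdges s' (s.nat 24 0) (cut u v E) ∧
        HoldsEdges s' (s.nat 24 0 + m) (merge u v E) ∧
        HoldsEdges s' (s.nat 24 0 + m + m) (remove v E) ∧
        s'.num 6 0 = (1 + s.num 1 0) ^ (between u v E).card := by
  set b := s.nat 24 0 with hb
  let Inv : ℕ → State → Prop := fun j s' =>
    AgreeOff [10, 11, 25, 28, 29, 32, 33, 34, 35, 36] s s' ∧
    (∀ i < b, s'.nat 10 i = s.nat 10 i ∧ s'.nat 11 i = s.nat 11 i) ∧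
    (∀ x i, x ≠ 6 → s'.num x i = s.num x i) ∧ s'.nat 25 0 = j ∧
    (∀ i : Fin m, i.val < j →
      (s'.nat 10 (b + i) = (cut u v E i).1 ∧ s'.nat 11 (b + i) = (cut u v E i).2) ∧
      (s'.nat 10 (b + m + i) = (merge u v E i).1 ∧ s'.nat 11 (b + m + i) = (merge u v E i).2) ∧
      (s'.nat 10 (b + m + m + i) = (remove v E i).1 ∧
        s'.nat 11 (b + m + m + i) = (remove v E i).2)) ∧
    s'.num 6 0 = (1 + s.num 1 0) ^ ((between u v E).filter fun i => i.val < j).card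
  refine (Runs.loopUpTo m Inv ?_ ?_ ?_).mono le_rfl ?_
  · rintro j - s' ⟨hf, -, -, h25, -⟩
    rw [holds_ltTest, scalar_eval, scalar_eval, h25, hf 1 (by decide), hm]
  · rintro j hjm s' ⟨hf, hlow, hnum, h25, hd, hp⟩
    refine Program.Straight.runs_of (by simp [childBody, childEnds, countEdge, storeEnds, block,
      select, Program.Straight, setScalar, setNumScalar, increment]) ?_
    -- All writes go to addresses from `b` on, and the edges of the current node lie below `b`, so
    -- they can still be read.
    have g22 : s'.nat 22 0 = s.nat 22 0 := hf 22 (by decide) 0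
    obtain ⟨a1, a2, a3, a4, a5, a6, a7, a8⟩ := run_childEnds (s := s') (E := E) (u := u) (v := v)
      ⟨j, hjm⟩
      (by rw [g22, h25, (hlow _ (by omega)).1]; exact (hE ⟨j, hjm⟩).1)
      (by rw [g22, h25, (hlow _ (by omega)).2]; exact (hE ⟨j, hjm⟩).2)
      (by rw [hf 26 (by decide), hu]) (by rw [hf 31 (by decide), hv])
    obtain ⟨b1, b2, b3⟩ := run_countEdge ⟨j, hjm⟩ a3 a4 a5 a6
    change Inv (j + 1) (storeEnds.run (countEdge.run (childEnds.run s')))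
    set s₁ := childEnds.run s'
    set s₂ := countEdge.run s₁
    have c24 : s₂.nat 24 0 = b := by rw [b1, a1 24 (by decide), hf 24 (by decide)]
    have c25 : s₂.nat 25 0 = j := by rw [b1, a1 25 (by decide), h25]
    have c1 : s₂.nat 1 0 = m := by rw [b1, a1 1 (by decide), hf 1 (by decide), hm]
    rw [← b1] at a3 a5 a6 a7 a8
    have hst : storeEnds.run s₂ = ((((((s₂.setNat 10 (b + j) (E ⟨j, hjm⟩).1).setNat 11 (b + j)
        (cut u v E ⟨j, hjm⟩).2).setNat 10 (b + j + m) (merge u v E ⟨j, hjm⟩).1).setNat 11 (b + j + m)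
        (merge u v E ⟨j, hjm⟩).2).setNat 10 (b + j + m + m) (E ⟨j, hjm⟩).1).setNat 11 (b + j + m + m)
        (remove v E ⟨j, hjm⟩).2).setNat 25 0 (j + 1) := by
      simp [storeEnds, block, Program.run, tailAddr, NatExp.eval, increment, setScalar, c24, c25,
        c1, a3, a5, a6, a7, a8]
    have d (x : ℕ) (hx : x ∉ [28, 29, 32, 33, 34, 35, 36]) (i : ℕ) : s₂.nat x i = s'.nat x i := by
      rw [b1, a1 x hx]
    have e1 : (cut u v E ⟨j, hjm⟩).1 = (E ⟨j, hjm⟩).1 := by unfold cut; split_ifs <;> rfl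
    have e2 : (remove v E ⟨j, hjm⟩).1 = (E ⟨j, hjm⟩).1 := by unfold remove; split_ifs <;> rfl
    rw [hst]
    refine ⟨fun x hx i => ?_, fun i hi => ?_, fun x i hx => ?_, by simp, fun i hi => ?_, ?_⟩
    · have hx' := hx
      simp only [List.mem_cons, List.not_mem_nil, or_false, not_or] at hx'
      simp only [State.setNat_nat, hx', false_and, if_false]
      rw [d x (by simp [hx']), hf x hx]
    · have n1 : i ≠ b + j := by omega
      have n2 : i ≠ b + j + m := by omega
      have n3 : i ≠ b + j + m + m := by omega
      simp [n1, n2, n3, d, hlow i hi]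
    · simp only [State.setNat_num]
      rw [b2 x i hx, a2, hnum x i hx]
    · rcases Nat.lt_succ_iff_lt_or_eq.1 hi with hi' | hi'
      · obtain ⟨⟨f1, f2⟩, ⟨f3, f4⟩, f5, f6⟩ := hd i hi'
        have n1 : b + i.val ≠ b + j := by omega
        have n2 : b + i.val ≠ b + j + m := by omega
        have n3 : b + i.val ≠ b + j + m + m := by omega
        have n4 : b + m + i.val ≠ b + j := by omega
        have n5 : b + m + i.val ≠ b + j + m := by omega
        have n6 : b + m + i.val ≠ b + j + m + m := by omega
        have n7 : b + m + m + i.val ≠ b + j := by omega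
        have n8 : b + m + m + i.val ≠ b + j + m := by omega
        have n9 : b + m + m + i.val ≠ b + j + m + m := by omega
        simp only [State.setNat_nat, n1, n2, n3, n4, n5, n6, n7, n8, n9, and_false, if_false,
          false_and, Nat.reduceEqDiff, d _ (by decide : (10 : ℕ) ∉ _),
          d _ (by decide : (11 : ℕ) ∉ _), f1, f2, f3, f4, f5, f6, and_self]
      · obtain rfl : i = ⟨j, hjm⟩ := Fin.ext hi'
        have m0 : m ≠ 0 := by omega
        have n2 : b + m + j = b + j + m := by omega
        have n3 : b + m + m + j = b + j + m + m := by omega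
        simp only [n2, n3, e1, e2, State.setNat_nat]
        simp [m0, Nat.add_assoc]
    · simp only [State.setNat_num]
      rw [b3, a2, hp, hnum 1 0 (by decide), ← pow_add, card_filter_lt_succ _ ⟨j, hjm⟩]
  · refine ⟨fun _ _ _ => rfl, fun _ _ => ⟨rfl, rfl⟩, fun _ _ _ => rfl, hj,
      fun i hi => absurd hi (Nat.not_lt_zero _), by simp [h6]⟩
  · rintro s' ⟨hf, hlow, hnum, -, hd, hp⟩
    refine ⟨hf, hlow, hnum, fun i => (hd i i.2).1, fun i => (hd i i.2).2.1,
      fun i => (hd i i.2).2.2, ?_⟩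
    rw [hp, Finset.filter_true_of_mem fun i _ => i.2]

/-! ### Growing the forest -/

/-- Register the three children of a node. -/
def appendChildren : Program := block
  [ .setNum 4 (scalar 21) (.div (.sub (numScalar 6) (.ofNat (.const 1))) (numScalar 0)),
    .setNat 12 (scalar 23) (.sub (.get 12 (scalar 21)) (.const 1)),
    .setNat 12 (.add (scalar 23) (.const 1)) (.sub (.get 12 (scalar 21)) (.const 1)),
    .setNat 12 (.add (scalar 23) (.const 2)) (.sub (.get 12 (scalar 21)) (.const 1)),
    .setNat 13 (scalar 23) (scalar 31),
    .setNat 13 (.add (scalar 23) (.const 1)) (scalar 31),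
    .setNat 13 (.add (scalar 23) (.const 2)) (scalar 26),
    .setNat 14 (scalar 21) (scalar 23),
    setScalar 24 (.add (.add (.add (scalar 24) (scalar 1)) (scalar 1)) (scalar 1)),
    setScalar 23 (.add (scalar 23) (.const 3)) ]

/-- Append the three children of a node with the neighbour in scalar `26`. -/
def expand : Program :=
  .seq (block [setScalar 25 (.const 0), setNumScalar 6 (.ofNat (.const 1))])
    (.seq childLoop appendChildren)

/-- Append the children of a node, if there are any. -/
def growNode : Program :=
  .branch (.natLe (.const 1) (.get 12 (scalar 21)))
    (.seq (block [setScalar 26 (scalar 31), setScalar 25 (.const 0)])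
      (.seq scanLoop (.branch (eqTest (scalar 26) (scalar 31)) .skip expand)))
    .skip

def growBody : Program :=
  .seq (setScalar 31 (.get 13 (scalar 21)))
    (.seq growNode (block [setScalar 22 (.add (scalar 22) (scalar 1)), increment 21]))

/-- Grow the forest from its roots. -/
def growLoop : Program := .loop (ltTest (scalar 21) (scalar 23)) growBody

/-- The `i`-th node has the depth `k`, the vertex `v` and the edge family `E`. -/
structure HoldsNode {m n : ℕ} (s : State) (i k : ℕ) (v : Fin n) (E : Fin m → Fin n × Fin n) :
    Prop where
  depth : s.nat 12 i = k
  vertex : s.nat 13 i = v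
  edges : HoldsEdges s (i * m) E

/-- The two memory configurations agree except for the children of the node `h`, which come after
the first `T` nodes. -/
structure Keeps (m T h : ℕ) (s s' : State) : Prop where
  scalars : ∀ x ∈ [0, 1, 20, 21, 22], s'.nat x 0 = s.nat x 0
  edges : ∀ i < T * m, s'.nat 10 i = s.nat 10 i ∧ s'.nat 11 i = s.nat 11 i
  nodes : ∀ i < T, s'.nat 12 i = s.nat 12 i ∧ s'.nat 13 i = s.nat 13 i
  children : ∀ i ≠ h, s'.nat 14 i = s.nat 14 i
  params : s'.num 0 0 = s.num 0 0 ∧ s'.num 1 0 = s.num 1 0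
  weights : ∀ i ≠ h, s'.num 4 i = s.num 4 i

theorem add_lt_mul_of_lt {m T i j : ℕ} (hi : i < T) (hj : j < m) : i * m + j < T * m :=
  calc i * m + j < i * m + m := Nat.add_lt_add_left hj _
    _ = (i + 1) * m := (Nat.succ_mul i m).symm
    _ ≤ T * m := Nat.mul_le_mul_right m hi

theorem Keeps.holdsNode_iff {m n T h : ℕ} {s s' : State} (hK : Keeps m T h s s') {i k : ℕ}
    (hi : i < T) {v : Fin n} {E : Fin m → Fin n × Fin n} :
    HoldsNode s' i k v E ↔ HoldsNode s i k v E := by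
  have h1 := hK.nodes i hi
  have h2 (j : Fin m) := hK.edges _ (add_lt_mul_of_lt hi j.2)
  constructor
  · rintro ⟨a, b, c⟩
    refine ⟨h1.1 ▸ a, h1.2 ▸ b, fun j => ?_⟩
    rw [← (h2 j).1, ← (h2 j).2]; exact c j
  · rintro ⟨a, b, c⟩
    refine ⟨h1.1.trans a, h1.2.trans b, fun j => ?_⟩
    rw [(h2 j).1, (h2 j).2]; exact c j

/-- The invariants speak about every description that fits a node; the memory determines it, so
checking one description is enough. -/
theorem HoldsNode.unique {m n : ℕ} {s : State} {i k k' : ℕ} {v v' : Fin n}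
    {E E' : Fin m → Fin n × Fin n} (h : HoldsNode s i k v E) (h' : HoldsNode s i k' v' E') :
    k = k' ∧ v = v' ∧ E = E' := by
  refine ⟨h.depth.symm.trans h'.depth, Fin.ext (h.vertex.symm.trans h'.vertex), ?_⟩
  funext j
  exact Prod.ext (Fin.ext ((h.edges j).1.symm.trans (h'.edges j).1))
    (Fin.ext ((h.edges j).2.symm.trans (h'.edges j).2))

/-- The three children of a node, beginning with the node `c`. -/
structure HasChildren {m n : ℕ} (s : State) (c k : ℕ) (u v : Fin n) (E : Fin m → Fin n × Fin n) :
    Prop where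
  cut : HoldsNode s c k v (cut u v E)
  merge : HoldsNode s (c + 1) k v (merge u v E)
  remove : HoldsNode s (c + 2) k u (remove v E)

/-- The constant is chosen before the sizes and the memory: it depends on the program text alone,
and the only loop runs over the `m` edges. The same holds for the other time bounds of this form. -/
theorem exists_runs_expand : ∃ c : ℕ, ∀ {m n : ℕ} {s : State} {E : Fin m → Fin n × Fin n}
    {u v : Fin n} {k h T : ℕ}, s.nat 1 0 = m → s.nat 23 0 = T → s.nat 24 0 = T * m →
    s.nat 21 0 = h → s.nat 22 0 = h * m → h < T → HoldsNode s h (k + 1) v E → s.nat 26 0 = u →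
    s.nat 31 0 = v →
    Runs expand s (c * (m + 1)) fun s' => Keeps m T h s s' ∧ s'.nat 23 0 = T + 3 ∧
      s'.nat 24 0 = (T + 3) * m ∧ s'.nat 14 h = T ∧ HasChildren s' T k u v E ∧
      s'.num 4 h = contractWeight (s.num 0 0) (s.num 1 0) u v E := by
  refine ⟨(block [setScalar 25 (.const 0), setNumScalar 6 (.ofNat (.const 1))]).bound +
    ((ltTest (scalar 25) (scalar 1)).cost + childBody.bound +
      (ltTest (scalar 25) (scalar 1)).cost) + appendChildren.bound, ?_⟩
  intro m n s E u v k h T hm hT htb hh hhb hlt hN hu hv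
  have hst : (block [setScalar 25 (.const 0), setNumScalar 6 (.ofNat (.const 1))]).Straight := by
    simp [block, Program.Straight, setScalar, setNumScalar]
  refine ((hst.runs s).seq (T' := m * ((ltTest (scalar 25) (scalar 1)).cost + childBody.bound) +
    (ltTest (scalar 25) (scalar 1)).cost + appendChildren.bound) fun s₁ h₁ => ?_).mono ?_
    fun _ h => h
  · have e : s₁ = (s.setNat 25 0 0).setNum 6 0 1 := by
      rw [h₁]
      simp [block, Program.run, setScalar, setNumScalar, NatExp.eval, NumExp.eval]
    have hle : h * m + m ≤ T * m := by
      rw [← Nat.succ_mul]; exact Nat.mul_le_mul_right m hlt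
    refine (runs_childLoop (s := s₁) (E := E) (u := u) (v := v) (by simp [e, hm]) ?_
      (by simpa [e, hhb, htb] using hle) (by simp [e, hu]) (by simp [e, hv]) (by simp [e])
      (by simp [e])).seq fun s₂ h₂ => Program.Straight.runs_of (p := appendChildren) ?_ ?_
    · simp only [e, State.setNum_nat, State.setNat_nat]
      simpa [HoldsEdges, hhb] using hN.edges
    · simp [appendChildren, block, Program.Straight, setScalar]
    · obtain ⟨hf, hlow, hnum, c1, c2, c3, h6⟩ := h₂
      have h24 : s₁.nat 24 0 = T * m := by simp [e, htb]
      rw [h24] at hlow c1 c2 c3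
      have f (x : ℕ) (hx : x ∉ [10, 11, 25, 28, 29, 32, 33, 34, 35, 36]) (i : ℕ) :
          s₂.nat x i = s.nat x i := by
        rw [hf x hx, e]
        simp only [List.mem_cons, List.not_mem_nil, or_false, not_or] at hx
        simp [hx]
      have fn (x i : ℕ) (hx : x ≠ 6) : s₂.num x i = s.num x i := by
        rw [hnum x i hx, e]; simp [hx]
      have h6' : s₂.num 6 0 = (1 + s.num 1 0) ^ (between u v E).card := by
        rw [h6, e]; simp
      have fd (i) : s₂.nat 12 i = s.nat 12 i := f 12 (by decide) i
      have f1 (i) : s₂.nat 1 i = s.nat 1 i := f 1 (by decide) i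
      have f13 (i) : s₂.nat 13 i = s.nat 13 i := f 13 (by decide) i
      have f14 (i) : s₂.nat 14 i = s.nat 14 i := f 14 (by decide) i
      have f21 (i) : s₂.nat 21 i = s.nat 21 i := f 21 (by decide) i
      have f23 (i) : s₂.nat 23 i = s.nat 23 i := f 23 (by decide) i
      have f24 (i) : s₂.nat 24 i = s.nat 24 i := f 24 (by decide) i
      have f26 (i) : s₂.nat 26 i = s.nat 26 i := f 26 (by decide) i
      have f31 (i) : s₂.nat 31 i = s.nat 31 i := f 31 (by decide) i
      have hdep : s.nat 12 h = k + 1 := hN.depth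
      have g0 : h ≠ T := by omega
      have g1 : h ≠ T + 1 := by omega
      have g2 : h ≠ T + 2 := by omega
      have hr : appendChildren.run s₂ = ((((((((((s₂.setNum 4 h
          (contractWeight (s.num 0 0) (s.num 1 0) u v E)).setNat 12 T k).setNat 12 (T + 1) k).setNat
          12 (T + 2) k).setNat 13 T v).setNat 13 (T + 1) v).setNat 13 (T + 2) u).setNat 14 h
          T).setNat 24 0 ((T + 3) * m)).setNat 23 0 (T + 3)) := by
        have : T * m + m + m + m = (T + 3) * m := by ring
        simp [appendChildren, block, Program.run, NatExp.eval, NumExp.eval, setScalar, fd, f1, f21,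
          f23, f24, f26, f31, hT, htb, hh, hu, hv, hm, hdep, h6', fn, contractWeight, this, g0, g1]
      rw [hr]
      have k1 : (T + 1) * m = T * m + m := by ring
      have k2 : (T + 2) * m = T * m + m + m := by ring
      refine ⟨⟨fun x hx => ?_, fun i hi => ?_, fun i hi => ?_, fun i hi => ?_, ?_, fun i hi => ?_⟩,
        by simp, by simp, by simp, ⟨⟨by simp, by simp, ?_⟩, ⟨by simp, by simp, ?_⟩,
          ⟨by simp, by simp, ?_⟩⟩, by simp⟩
      · simp only [List.mem_cons, List.not_mem_nil, or_false] at hx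
        rcases hx with rfl | rfl | rfl | rfl | rfl <;> simp [f]
      · have := hlow i hi
        rw [e] at this
        simpa using this
      · have n0 : i ≠ T := by omega
        have n1 : i ≠ T + 1 := by omega
        have n2 : i ≠ T + 2 := by omega
        simp [n0, n1, n2, fd, f13]
      · simp [hi, f14]
      · simp [fn]
      · simp [hi, fn]
      · simpa [HoldsEdges] using c1
      · rw [k1]; simpa [HoldsEdges] using c2
      · rw [k2]; simpa [HoldsEdges] using c3
  · generalize (block [setScalar 25 (.const 0), setNumScalar 6 (.ofNat (.const 1))]).bound = A
    generalize (ltTest (scalar 25) (scalar 1)).cost = B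
    generalize childBody.bound = C
    generalize appendChildren.bound = D
    nlinarith [Nat.zero_le (A * m), Nat.zero_le (B * m), Nat.zero_le (D * m)]

theorem exists_runs_growNode : ∃ c : ℕ, ∀ {m n : ℕ} {s : State} {E : Fin m → Fin n × Fin n}
    {v : Fin n} {k h T : ℕ}, s.nat 1 0 = m → s.nat 23 0 = T → s.nat 24 0 = T * m →
    s.nat 21 0 = h → s.nat 22 0 = h * m → h < T → HoldsNode s h k v E → s.nat 31 0 = v →
    Runs growNode s (c * (m + 1)) fun s' => Keeps m T h s s' ∧
      ((k = 0 ∨ liveDegree E v = 0) ∧ s'.nat 23 0 = T ∧ s'.nat 24 0 = T * m ∧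
          s'.nat 14 h = s.nat 14 h ∨
        ∃ k' u, k = k' + 1 ∧ (between u v E).Nonempty ∧ s'.nat 23 0 = T + 3 ∧
          s'.nat 24 0 = (T + 3) * m ∧ s'.nat 14 h = T ∧ HasChildren s' T k' u v E ∧
          s'.num 4 h = contractWeight (s.num 0 0) (s.num 1 0) u v E) := by
  obtain ⟨c₀, hc₀⟩ := exists_runs_expand
  refine ⟨(Test.natLe (.const 1) (.get 12 (scalar 21))).cost +
    ((block [setScalar 26 (scalar 31), setScalar 25 (.const 0)]).bound +
    ((ltTest (scalar 25) (scalar 1)).cost + scanBody.bound +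
      (ltTest (scalar 25) (scalar 1)).cost) + ((eqTest (scalar 26) (scalar 31)).cost + c₀ + 1)), ?_⟩
  intro m n s E v k h T hm hT htb hh hhb hlt hN hv
  have keepsRefl : ∀ s', (AgreeOff [25, 26] s s' ∧ s'.num = s.num) → Keeps m T h s s' := by
    rintro s' ⟨hf, hn⟩
    refine ⟨fun x hx => hf x ?_ 0, fun i _ => ⟨hf 10 (by decide) i, hf 11 (by decide) i⟩,
      fun i _ => ⟨hf 12 (by decide) i, hf 13 (by decide) i⟩, fun i _ => hf 14 (by decide) i,
      by simp [hn], by simp [hn]⟩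
    simp only [List.mem_cons, List.not_mem_nil, or_false] at hx
    rcases hx with rfl | rfl | rfl | rfl | rfl <;> decide
  have hst : (block [setScalar 26 (scalar 31), setScalar 25 (.const 0)]).Straight := by
    simp [block, Program.Straight, setScalar]
  refine (Runs.branch (T := (block [setScalar 26 (scalar 31), setScalar 25 (.const 0)]).bound +
    ((m * ((ltTest (scalar 25) (scalar 1)).cost + scanBody.bound) +
        (ltTest (scalar 25) (scalar 1)).cost) + ((eqTest (scalar 26) (scalar 31)).cost +
      (c₀ * (m + 1) + 1)))) (fun hb => ?_) fun hb => ?_).mono ?_ fun _ h => h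
  · have hk : 1 ≤ k := by simpa [Test.Holds, NatExp.eval, hh, hN.depth] using hb
    refine (hst.runs s).seq fun s₁ h₁ => ?_
    have e : s₁ = (s.setNat 26 0 v).setNat 25 0 0 := by
      rw [h₁]; simp [block, Program.run, setScalar, NatExp.eval, hv]
    refine (runs_scanLoop (s := s₁) (E := E) (v := v) (by simp [e, hm]) ?_ (by simp [e, hv])
      (by simp [e]) (by simp [e])).seq fun s₂ ⟨hf, hn, hd⟩ => ?_
    · simp only [e, State.setNat_nat]
      simpa [HoldsEdges, hhb] using hN.edges
    have hf' : AgreeOff [25, 26] s s₂ := fun x hx i => by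
      rw [hf x hx, e]
      simp only [List.mem_cons, List.not_mem_nil, or_false, not_or] at hx
      simp [hx]
    have hn' : s₂.num = s.num := by rw [hn, e]; rfl
    have hK := keepsRefl s₂ ⟨hf', hn'⟩
    have g31 : s₂.nat 31 0 = v := by rw [hf' 31 (by decide), hv]
    have g23 : s₂.nat 23 0 = T := by rw [hf' 23 (by decide), hT]
    have g24 : s₂.nat 24 0 = T * m := by rw [hf' 24 (by decide), htb]
    refine Runs.branch (fun hb₂ => ?_) fun hb₂ => ?_
    · rw [holds_eqTest, scalar_eval, scalar_eval, g31] at hb₂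
      have h0 : liveDegree E v = 0 := by
        rcases hd with hd | ⟨u, hu, hne⟩
        · exact hd.2
        · rw [hu, Fin.val_inj] at hb₂
          exact absurd hb₂ (ne_of_between hne)
      refine ⟨s₂, 1, .skip s₂, by omega, hK, Or.inl ⟨Or.inr h0, g23, g24, hf' 14 (by decide) h⟩⟩
    · rw [holds_eqTest, scalar_eval, scalar_eval, g31] at hb₂
      obtain ⟨u, hu, hne⟩ := hd.resolve_left fun h => hb₂ h.1
      obtain ⟨k', rfl⟩ : ∃ k', k = k' + 1 := ⟨k - 1, by omega⟩
      refine (hc₀ (s := s₂) (E := E) (u := u) (v := v) (k := k') (h := h) (T := T)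
        (by rw [hf' 1 (by decide), hm]) g23 g24 (by rw [hf' 21 (by decide), hh])
        (by rw [hf' 22 (by decide), hhb]) hlt ((hK.holdsNode_iff hlt).2 hN) hu g31).mono
        (by omega) ?_
      rintro s' ⟨hK', a, b, c, d, f⟩
      refine ⟨⟨fun x hx => (hK'.scalars x hx).trans (hK.scalars x hx), fun i hi => ?_,
        fun i hi => ?_, fun i hi => (hK'.children i hi).trans (hK.children i hi), ?_,
        fun i hi => (hK'.weights i hi).trans (hK.weights i hi)⟩,
        Or.inr ⟨k', u, rfl, hne, a, b, c, d, by rw [f, hn']⟩⟩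
      · exact ⟨(hK'.edges i hi).1.trans (hK.edges i hi).1,
          (hK'.edges i hi).2.trans (hK.edges i hi).2⟩
      · exact ⟨(hK'.nodes i hi).1.trans (hK.nodes i hi).1,
          (hK'.nodes i hi).2.trans (hK.nodes i hi).2⟩
      · exact ⟨hK'.params.1.trans hK.params.1, hK'.params.2.trans hK.params.2⟩
  · have hk : k = 0 := by simpa [Test.Holds, NatExp.eval, hh, hN.depth] using hb
    exact ⟨s, 1, .skip s, by omega, keepsRefl s ⟨fun _ _ _ => rfl, rfl⟩,
      Or.inl ⟨Or.inl hk, hT, htb, rfl⟩⟩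
  · generalize (block [setScalar 26 (scalar 31), setScalar 25 (.const 0)]).bound = A
    generalize (ltTest (scalar 25) (scalar 1)).cost = B
    generalize scanBody.bound = C
    generalize (eqTest (scalar 26) (scalar 31)).cost = D
    generalize (Test.natLe (.const 1) (.get 12 (scalar 21))).cost = F
    nlinarith [Nat.zero_le (A * m), Nat.zero_le (B * m), Nat.zero_le (D * m), Nat.zero_le (F * m)]

/-- The node `i` is a leaf, or has got its children among the first `T` nodes. -/
def Resolved {m n : ℕ} (q w : ℂ) (s : State) (T i k : ℕ) (v : Fin n)
    (E : Fin m → Fin n × Fin n) : Prop :=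
  s.nat 14 i = 0 ∧ (k = 0 ∨ liveDegree E v = 0) ∨
    ∃ k' u, k = k' + 1 ∧ (between u v E).Nonempty ∧ i < s.nat 14 i ∧ s.nat 14 i + 2 < T ∧
      HasChildren s (s.nat 14 i) k' u v E ∧ s.num 4 i = contractWeight q w u v E

/-- The invariant of the growth of the forest: `h` of the `T` nodes have been processed. -/
structure ForestInv {m n : ℕ} (q w : ℂ) (K : ℕ) (E₀ : Fin m → Fin n × Fin n) (h T : ℕ)
    (s : State) : Prop where
  vertices : s.nat 0 0 = n
  size : s.nat 1 0 = m
  param_q : s.num 0 0 = q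
  param_w : s.num 1 0 = w
  head : s.nat 21 0 = h
  headAddr : s.nat 22 0 = h * m
  tail : s.nat 23 0 = T
  tailAddr : s.nat 24 0 = T * m
  head_le : h ≤ T
  le_tail : n ≤ T
  roots : ∀ i : Fin n, HoldsNode s i K i (dropBelow i E₀)
  nodes : ∀ i < T, ∃ k v, ∃ E : Fin m → Fin n × Fin n, HoldsNode s i k v E
  resolved : ∀ i < h, ∀ k v, ∀ E : Fin m → Fin n × Fin n, HoldsNode s i k v E →
    Resolved q w s T i k v E
  unresolved : ∀ i, h ≤ i → s.nat 14 i = 0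
  potential : h + ∑ i ∈ Finset.Ico h T, 4 ^ s.nat 12 i ≤ n * 4 ^ K

theorem HasChildren.keeps {m n T h c k : ℕ} {s s' : State} {u v : Fin n}
    {E : Fin m → Fin n × Fin n} (hC : HasChildren s c k u v E) (hK : Keeps m T h s s')
    (hc : c + 2 < T) : HasChildren s' c k u v E :=
  ⟨(hK.holdsNode_iff (by omega)).2 hC.cut, (hK.holdsNode_iff (by omega)).2 hC.merge,
    (hK.holdsNode_iff (by omega)).2 hC.remove⟩

/-- Termination rests on the potential in `ForestInv`: an unprocessed node of depth k counts 4^k, a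
processed one counts 1. Since 1 + 3 · 4^k ≤ 4^(k+1), replacing a node by its three children does not
increase the total. -/
theorem exists_runs_growBody : ∃ c : ℕ, ∀ {m n : ℕ} {q w : ℂ} {K : ℕ}
    {E₀ : Fin m → Fin n × Fin n} {h T : ℕ} {s : State}, ForestInv q w K E₀ h T s → h < T →
    Runs growBody s (c * (m + 1)) fun s' => ∃ T', ForestInv q w K E₀ (h + 1) T' s' := by
  obtain ⟨c₀, hc₀⟩ := exists_runs_growNode
  refine ⟨(setScalar 31 (.get 13 (scalar 21))).bound + c₀ +
    (block [setScalar 22 (.add (scalar 22) (scalar 1)), increment 21]).bound, ?_⟩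
  intro m n q w K E₀ h T s hI hlt
  have hst : (setScalar 31 (.get 13 (scalar 21))).Straight := trivial
  refine ((hst.runs s).seq (T' := c₀ * (m + 1) +
    (block [setScalar 22 (.add (scalar 22) (scalar 1)), increment 21]).bound)
    fun s₁ h₁ => ?_).mono ?_ fun _ h => h
  swap
  · generalize (setScalar 31 (.get 13 (scalar 21))).bound = A
    generalize (block [setScalar 22 (.add (scalar 22) (scalar 1)), increment 21]).bound = B
    nlinarith [Nat.zero_le (A * m), Nat.zero_le (B * m)]
  obtain ⟨k, v, E, hN⟩ := hI.nodes h hlt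
  have e : s₁ = s.setNat 31 0 v := by
    rw [h₁]; simp [Program.run, setScalar, NatExp.eval, hI.head, hN.vertex]
  have hN₁ : HoldsNode s₁ h k v E := by
    rw [e]
    exact ⟨by simpa using hN.depth, by simpa using hN.vertex, by simpa [HoldsEdges] using hN.edges⟩
  refine (hc₀ (s := s₁) (E := E) (v := v) (k := k) (h := h) (T := T) (by simp [e, hI.size])
    (by simp [e, hI.tail]) (by simp [e, hI.tailAddr]) (by simp [e, hI.head])
    (by simp [e, hI.headAddr]) hlt hN₁ (by simp [e])).seq fun s₂ ⟨hK₂, hd⟩ =>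
      Program.Straight.runs_of (by simp [block, Program.Straight, setScalar, increment]) ?_
  have hK : Keeps m T h s s₂ := by
    rw [e] at hK₂
    refine ⟨fun x hx => ?_, fun i hi => ?_, fun i hi => ?_, fun i hi => ?_, ?_, fun i hi => ?_⟩
    · rw [hK₂.scalars x hx]
      simp only [List.mem_cons, List.not_mem_nil, or_false] at hx
      rcases hx with rfl | rfl | rfl | rfl | rfl <;> simp
    · simpa using hK₂.edges i hi
    · simpa using hK₂.nodes i hi
    · simpa using hK₂.children i hi
    · simpa using hK₂.params
    · simpa using hK₂.weights i hi
  have g1 : s₂.nat 1 0 = m := by rw [hK.scalars 1 (by decide), hI.size]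
  have g21 : s₂.nat 21 0 = h := by rw [hK.scalars 21 (by decide), hI.head]
  have g22 : s₂.nat 22 0 = h * m := by rw [hK.scalars 22 (by decide), hI.headAddr]
  have hr : (block [setScalar 22 (.add (scalar 22) (scalar 1)), increment 21]).run s₂ =
      (s₂.setNat 22 0 ((h + 1) * m)).setNat 21 0 (h + 1) := by
    simp [block, Program.run, setScalar, increment, NatExp.eval, g1, g21, g22, Nat.succ_mul]
  rw [hr]
  set s₃ := (s₂.setNat 22 0 ((h + 1) * m)).setNat 21 0 (h + 1) with hs₃
  have node₃ (i k : ℕ) (v : Fin n) (E : Fin m → Fin n × Fin n) :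
      HoldsNode s₃ i k v E ↔ HoldsNode s₂ i k v E := by
    constructor <;> rintro ⟨a, b, c⟩ <;>
      exact ⟨by simpa [hs₃] using a, by simpa [hs₃] using b, by simpa [HoldsEdges, hs₃] using c⟩
  have kids₃ {c k : ℕ} {u v : Fin n} {E : Fin m → Fin n × Fin n}
      (hC : HasChildren s₂ c k u v E) : HasChildren s₃ c k u v E :=
    ⟨(node₃ _ _ _ _).2 hC.cut, (node₃ _ _ _ _).2 hC.merge, (node₃ _ _ _ _).2 hC.remove⟩
  have old {i : ℕ} (hi : i < T) (k : ℕ) (v : Fin n) (E : Fin m → Fin n × Fin n) :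
      HoldsNode s₃ i k v E ↔ HoldsNode s i k v E :=
    (node₃ _ _ _ _).trans (hK.holdsNode_iff hi)
  have nat₃ (x i : ℕ) (h1 : x ≠ 21) (h2 : x ≠ 22) : s₃.nat x i = s₂.nat x i := by
    simp [hs₃, h1, h2]
  -- Nodes processed earlier keep their children, because only the entries of `h` and of the fresh
  -- nodes from `T` on are written.
  have resolvedOld (T' : ℕ) (hT' : T ≤ T') : ∀ i < h, ∀ k v, ∀ E : Fin m → Fin n × Fin n,
      HoldsNode s₃ i k v E → Resolved q w s₃ T' i k v E := by
    intro i hi k v E hN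
    have e14 : s₃.nat 14 i = s.nat 14 i := by
      rw [nat₃ 14 i (by decide) (by decide), hK.children i (by omega)]
    have e4 : s₃.num 4 i = s.num 4 i := by
      simp [hs₃, hK.weights i (by omega : i ≠ h)]
    rw [Resolved, e14, e4]
    rcases hI.resolved i hi k v E ((old (by omega) k v E).1 hN) with hl | ⟨k', u, a, b, c, d, f, g⟩
    · exact Or.inl hl
    · exact Or.inr ⟨k', u, a, b, c, by omega, kids₃ (f.keeps hK d), g⟩
  have unres : ∀ i, h + 1 ≤ i → s₃.nat 14 i = 0 := fun i hi => by
    rw [nat₃ 14 i (by decide) (by decide), hK.children i (by omega), hI.unresolved i (by omega)]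
  have dep {i : ℕ} (hi : i < T) : s₃.nat 12 i = s.nat 12 i := by
    rw [nat₃ 12 i (by decide) (by decide), (hK.nodes i hi).1]
  have sumOld : ∑ i ∈ Finset.Ico (h + 1) T, 4 ^ s₃.nat 12 i =
      ∑ i ∈ Finset.Ico (h + 1) T, 4 ^ s.nat 12 i :=
    Finset.sum_congr rfl fun i hi => by rw [dep (Finset.mem_Ico.1 hi).2]
  have pot := hI.potential
  rw [Finset.sum_eq_sum_Ico_succ_bot hlt, hN.depth] at pot
  have roots' (i : Fin n) : HoldsNode s₃ i K i (dropBelow i E₀) :=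
    (old (i.2.trans_le hI.le_tail) _ _ _).2 (hI.roots i)
  have g0 : s₃.nat 0 0 = n := by
    rw [nat₃ 0 0 (by decide) (by decide), hK.scalars 0 (by decide), hI.vertices]
  have g1' : s₃.nat 1 0 = m := by rw [nat₃ 1 0 (by decide) (by decide), g1]
  have gq : s₃.num 0 0 = q := by simp [hs₃, hK.params.1, hI.param_q]
  have gw : s₃.num 1 0 = w := by simp [hs₃, hK.params.2, hI.param_w]
  have g21' : s₃.nat 21 0 = h + 1 := by simp [hs₃]
  have g22' : s₃.nat 22 0 = (h + 1) * m := by simp [hs₃]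
  rcases hd with ⟨hleaf, t1, t2, t3⟩ | ⟨k', u, rfl, hne, t1, t2, t3, t4, t5⟩
  · refine ⟨T, g0, g1', gq, gw, g21', g22', by rw [nat₃ 23 0 (by decide) (by decide), t1],
      by rw [nat₃ 24 0 (by decide) (by decide), t2], hlt, hI.le_tail, roots', fun i hi => ?_,
      fun i hi k₁ v₁ E₁ hN₁' => ?_, unres, ?_⟩
    · obtain ⟨k₁, v₁, E₁, hN'⟩ := hI.nodes i hi
      exact ⟨k₁, v₁, E₁, (old hi _ _ _).2 hN'⟩
    · rcases Nat.lt_succ_iff_lt_or_eq.1 hi with hi | rfl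
      · exact resolvedOld T le_rfl i hi k₁ v₁ E₁ hN₁'
      · obtain ⟨rfl, rfl, rfl⟩ := hN.unique ((old hlt _ _ _).1 hN₁')
        refine Or.inl ⟨?_, hleaf⟩
        rw [nat₃ 14 i (by decide) (by decide), t3, e]
        simpa using hI.unresolved i le_rfl
    · rw [sumOld]
      have : 1 ≤ 4 ^ k := Nat.one_le_pow _ _ (by norm_num)
      omega
  · refine ⟨T + 3, g0, g1', gq, gw, g21', g22', by rw [nat₃ 23 0 (by decide) (by decide), t1],
      by rw [nat₃ 24 0 (by decide) (by decide), t2], by omega, hI.le_tail.trans (by omega), roots',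
      fun i hi => ?_, fun i hi k₁ v₁ E₁ hN₁' => ?_, unres, ?_⟩
    · by_cases hiT : i < T
      · obtain ⟨k₁, v₁, E₁, hN'⟩ := hI.nodes i hiT
        exact ⟨k₁, v₁, E₁, (old hiT _ _ _).2 hN'⟩
      · have : i = T ∨ i = T + 1 ∨ i = T + 2 := by omega
        rcases this with rfl | rfl | rfl
        · exact ⟨_, _, _, (kids₃ t4).cut⟩
        · exact ⟨_, _, _, (kids₃ t4).merge⟩
        · exact ⟨_, _, _, (kids₃ t4).remove⟩
    · rcases Nat.lt_succ_iff_lt_or_eq.1 hi with hi | rfl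
      · exact resolvedOld (T + 3) (by omega) i hi k₁ v₁ E₁ hN₁'
      · obtain ⟨rfl, rfl, rfl⟩ := hN.unique ((old hlt _ _ _).1 hN₁')
        have e14 : s₃.nat 14 i = T := by rw [nat₃ 14 i (by decide) (by decide), t3]
        refine Or.inr ⟨k', u, rfl, hne, by omega, by omega, by rw [e14]; exact kids₃ t4, ?_⟩
        have : s₃.num 4 i = s₂.num 4 i := rfl
        rw [this, t5, e, State.setNat_num, hI.param_q, hI.param_w]
    · have d0 : s₃.nat 12 T = k' := (kids₃ t4).cut.depth
      have d1 : s₃.nat 12 (T + 1) = k' := (kids₃ t4).merge.depth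
      have d2 : s₃.nat 12 (T + 2) = k' := (kids₃ t4).remove.depth
      rw [Finset.sum_Ico_succ_top (by omega), Finset.sum_Ico_succ_top (by omega),
        Finset.sum_Ico_succ_top (by omega), sumOld, d0, d1, d2]
      have : 1 ≤ 4 ^ k' := Nat.one_le_pow _ _ (by norm_num)
      rw [pow_succ] at pot
      omega

theorem exists_runs_growLoop : ∃ c : ℕ, ∀ {m n : ℕ} {q w : ℂ} {K : ℕ}
    {E₀ : Fin m → Fin n × Fin n} {T : ℕ} {s : State}, ForestInv q w K E₀ 0 T s →
    Runs growLoop s (c * ((n * 4 ^ K + 1) * (m + 1)))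
      fun s' => ∃ T' ≤ n * 4 ^ K, ForestInv q w K E₀ T' T' s' := by
  obtain ⟨c, hc⟩ := exists_runs_growBody
  refine ⟨(ltTest (scalar 21) (scalar 23)).cost + c, ?_⟩
  intro m n q w K E₀ T s hI
  refine (Runs.loop (T := c * (m + 1))
    (fun N s' => ∃ h T', N + h = n * 4 ^ K ∧ ForestInv q w K E₀ h T' s') ?_
    (N := n * 4 ^ K) ⟨0, T, rfl, hI⟩).mono ?_ ?_
  · rintro N s' ⟨h, T', hN, hI'⟩ hb
    rw [holds_ltTest, scalar_eval, scalar_eval, hI'.head, hI'.tail] at hb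
    refine (hc hI' hb).mono le_rfl ?_
    rintro s'' ⟨T'', hI''⟩
    -- The potential bounds the number h + 1 of processed nodes by n · 4^K, so a further iteration
    -- was still available.
    have := hI''.potential
    exact ⟨N - 1, by omega, h + 1, T'', by omega, hI''⟩
  · generalize (ltTest (scalar 21) (scalar 23)).cost = A
    generalize n * 4 ^ K = B
    nlinarith [Nat.zero_le (A * m), Nat.zero_le (B * A * m), Nat.zero_le (c * (m + 1))]
  · rintro s' ⟨⟨N, h, T', hN, hI'⟩, hb⟩
    rw [holds_ltTest, scalar_eval, scalar_eval, hI'.head, hI'.tail] at hb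
    obtain rfl : h = T' := le_antisymm hI'.head_le (not_lt.1 hb)
    exact ⟨h, by omega, hI'⟩

/-! ### Evaluating the forest and multiplying the roots -/

/-- The first child of the node that is being processed. -/
def firstChild : NatExp := .get 14 (scalar 21)

def evaluateBody : Program := block
  [ setScalar 21 (.sub (scalar 21) (.const 1)),
    .branch (.natLe (.const 1) firstChild)
      (.setNum 5 (scalar 21) (.add (.get 5 firstChild)
        (.div (.mul (.get 4 (scalar 21)) (.get 5 (.add firstChild (.const 1))))
          (.get 5 (.add firstChild (.const 2))))))
      (.setNum 5 (scalar 21) (.ofNat (.const 1))) ]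

/-- Evaluate the nodes from the last one to the first one. -/
def evaluateLoop : Program := .loop (.natLe (.const 1) (scalar 21)) evaluateBody

/-- Children are appended after their parent, so in descending order their values are ready when the
parent is reached. -/
theorem exists_runs_evaluateLoop : ∃ c : ℕ, ∀ {m n : ℕ} {q w : ℂ} {T : ℕ} {s : State},
    s.nat 21 0 = T →
    (∀ i < T, ∀ k v, ∀ E : Fin m → Fin n × Fin n, HoldsNode s i k v E →
      Resolved q w s T i k v E) →
    Runs evaluateLoop s (c * (T + 1)) fun s' => AgreeOff [21] s s' ∧
      (∀ x i, x ≠ 5 → s'.num x i = s.num x i) ∧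
      ∀ i < T, ∀ k v, ∀ E : Fin m → Fin n × Fin n, HoldsNode s i k v E →
        IsApproxRatio q w k E v (s'.num 5 i) := by
  refine ⟨(Test.natLe (.const 1) (scalar 21)).cost + evaluateBody.bound, ?_⟩
  intro m n q w T s hT hres
  let Inv : ℕ → State → Prop := fun j s' => AgreeOff [21] s s' ∧
      (∀ x i, x ≠ 5 → s'.num x i = s.num x i) ∧ s'.nat 21 0 = T - j ∧
      ∀ i < T, T - j ≤ i → ∀ k v, ∀ E : Fin m → Fin n × Fin n, HoldsNode s i k v E →
        IsApproxRatio q w k E v (s'.num 5 i)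
  refine (Runs.loopUpTo (T := evaluateBody.bound) T Inv ?_ ?_ ?_).mono ?_ ?_
  · rintro j - s' ⟨-, -, h21, -⟩
    simp only [Test.Holds, NatExp.eval, scalar_eval, h21]
    omega
  · rintro j hj s' ⟨hf, hn, h21, hd⟩
    refine Program.Straight.runs_of
      (by simp [evaluateBody, block, Program.Straight, setScalar]) ?_
    obtain ⟨h, hh⟩ : ∃ h, h = T - (j + 1) := ⟨_, rfl⟩
    have h21' : s'.nat 21 0 - 1 = h := by omega
    have f14 (i) : s'.nat 14 i = s.nat 14 i := hf 14 (by decide) i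
    have f4 (i) : s'.num 4 i = s.num 4 i := hn 4 i (by decide)
    have conclude (x : ℂ) (hr : evaluateBody.run s' = (s'.setNat 21 0 h).setNum 5 h x)
        (hx : ∀ k v, ∀ E : Fin m → Fin n × Fin n, HoldsNode s h k v E →
          IsApproxRatio q w k E v x) : Inv (j + 1) (evaluateBody.run s') := by
      rw [hr]
      refine ⟨fun x hx i => ?_, fun x i hx => ?_, by simp [hh], fun i hi hji k v E hN => ?_⟩
      · rw [← hf x hx i]
        simp only [List.mem_cons, List.not_mem_nil, or_false] at hx
        simp [hx]
      · simp [hx, hn x i hx]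
      · by_cases hih : i = h
        · subst hih
          simpa using hx k v E hN
        · have := hd i hi (by omega) k v E hN
          simpa [hih] using this
    by_cases hc : s.nat 14 h = 0
    · refine conclude 1 ?_ fun k v E hN => ?_
      · simp [evaluateBody, block, Program.run, setScalar, firstChild, NatExp.eval, NumExp.eval,
          Test.Holds, h21', f14, hc]
      -- The entry 0 marks a leaf unambiguously: a first child has a larger index than its parent
      -- and is never the node 0.
      · rcases hres h (by omega) k v E hN with ⟨-, rfl | h0⟩ | ⟨k', u, -, -, hlt, -⟩
        · exact .zero E v
        · exact .isolated k E v h0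
        · omega
    · refine conclude (s'.num 5 (s.nat 14 h) + s.num 4 h * s'.num 5 (s.nat 14 h + 1) /
        s'.num 5 (s.nat 14 h + 2)) ?_ fun k v E hN => ?_
      · have : 1 ≤ s.nat 14 h := by omega
        simp [evaluateBody, block, Program.run, setScalar, firstChild, NatExp.eval, NumExp.eval,
          Test.Holds, h21', f14, f4, this]
      · rcases hres h (by omega) k v E hN with ⟨h0, -⟩ | ⟨k', u, rfl, hne, hlt, hlt', hC, h4⟩
        · exact absurd h0 hc
        · rw [h4]
          exact .step k' E u v _ _ _ hne (hd _ (by omega) (by omega) _ _ _ hC.cut)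
            (hd _ (by omega) (by omega) _ _ _ hC.merge)
            (hd _ (by omega) (by omega) _ _ _ hC.remove)
  · exact ⟨fun _ _ _ => rfl, fun _ _ _ => rfl, by simpa using hT, fun i hi hi' => by omega⟩
  · generalize (Test.natLe (.const 1) (scalar 21)).cost = A
    generalize evaluateBody.bound = B
    nlinarith
  · rintro s' ⟨hf, hn, -, hd⟩
    exact ⟨hf, hn, fun i hi => hd i hi (by omega)⟩

def multiplyBody : Program := block
  [ setNumScalar 3 (.mul (numScalar 3) (.mul (numScalar 0) (.get 5 (scalar 25)))), increment 25 ]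

/-- Multiply the values of the roots and the power of `q`. -/
def multiply : Program :=
  .seq (block [setNumScalar 3 (.ofNat (.const 1)), setScalar 25 (.const 0)])
    (.loop (ltTest (scalar 25) (scalar 0)) multiplyBody)

theorem exists_runs_multiply : ∃ c : ℕ, ∀ (s : State),
    Runs multiply s (c * (s.nat 0 0 + 1)) fun s' =>
      s'.output = ∏ i : Fin (s.nat 0 0), s.num 0 0 * s.num 5 i := by
  refine ⟨(block [setNumScalar 3 (.ofNat (.const 1)), setScalar 25 (.const 0)]).bound +
    ((ltTest (scalar 25) (scalar 0)).cost + multiplyBody.bound), fun s => ?_⟩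
  have hst : (block [setNumScalar 3 (.ofNat (.const 1)), setScalar 25 (.const 0)]).Straight := by
    simp [block, Program.Straight, setScalar, setNumScalar]
  refine ((hst.runs s).seq (T' := s.nat 0 0 * ((ltTest (scalar 25) (scalar 0)).cost +
    multiplyBody.bound) + (ltTest (scalar 25) (scalar 0)).cost) fun s₁ h₁ => ?_).mono ?_
    fun _ h => h
  · have e : s₁ = (s.setNum 3 0 1).setNat 25 0 0 := by
      rw [h₁]
      simp [block, Program.run, setScalar, setNumScalar, NatExp.eval, NumExp.eval]
    refine (Runs.loopUpTo (s.nat 0 0) (fun j s' => s'.nat 25 0 = j ∧ s'.nat 0 0 = s.nat 0 0 ∧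
      (∀ x i, x ≠ 3 → s'.num x i = s.num x i) ∧
      s'.num 3 0 = ∏ i ∈ Finset.range j, s.num 0 0 * s.num 5 i) ?_ ?_ ?_).mono le_rfl ?_
    · rintro j - s' ⟨h25, h0, -⟩
      rw [holds_ltTest, scalar_eval, scalar_eval, h25, h0]
    · rintro j - s' ⟨h25, h0, hn, h3⟩
      refine Program.Straight.runs_of (by simp [multiplyBody, block, Program.Straight, increment,
        setScalar, setNumScalar]) ?_
      have hr : multiplyBody.run s' =
          (s'.setNum 3 0 (s'.num 3 0 * (s.num 0 0 * s.num 5 j))).setNat 25 0 (j + 1) := by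
        simp [multiplyBody, block, Program.run, setScalar, setNumScalar, NatExp.eval, NumExp.eval,
          increment, h25, hn]
      rw [hr]
      refine ⟨by simp, by simp [h0], fun x i hx => by simp [hx, hn x i hx], ?_⟩
      rw [Finset.prod_range_succ, ← h3]
      simp
    · rw [e]
      refine ⟨by simp, by simp, fun x i hx => by simp [hx], by simp⟩
    · rintro s' ⟨-, -, -, h3⟩
      rw [State.output, h3, Finset.prod_range]
  · generalize (block [setNumScalar 3 (.ofNat (.const 1)), setScalar 25 (.const 0)]).bound = A
    generalize (ltTest (scalar 25) (scalar 0)).cost = B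
    generalize multiplyBody.bound = C
    nlinarith [Nat.zero_le (A * s.nat 0 0)]

/-! ### Writing the roots -/

def rootEdgeBody : Program := block
  [ setScalar 32 (.get 2 (scalar 25)), setScalar 33 (.get 3 (scalar 25)),
    setScalar 34 (scalar 32),
    .branch (.natLe (scalar 23) (scalar 32))
      (.branch (.natLe (scalar 23) (scalar 33)) (setScalar 34 (scalar 33)) .skip) .skip,
    .setNat 10 tailAddr (scalar 32), .setNat 11 tailAddr (scalar 34), increment 25 ]

/-- Write the edges of a root. -/
def rootEdgeLoop : Program := .loop (ltTest (scalar 25) (scalar 1)) rootEdgeBody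

theorem runs_rootEdgeLoop {m n : ℕ} {s : State} {E : Fin m → Fin n × Fin n} {t b : ℕ}
    (hm : s.nat 1 0 = m) (hE : ∀ i : Fin m, s.nat 2 i = (E i).1 ∧ s.nat 3 i = (E i).2)
    (ht : s.nat 23 0 = t) (hb : s.nat 24 0 = b) (hj : s.nat 25 0 = 0) :
    Runs rootEdgeLoop s (m * ((ltTest (scalar 25) (scalar 1)).cost + rootEdgeBody.bound) +
        (ltTest (scalar 25) (scalar 1)).cost)
      fun s' => AgreeOff [10, 11, 25, 32, 33, 34] s s' ∧ s'.num = s.num ∧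
        (∀ i < b, s'.nat 10 i = s.nat 10 i ∧ s'.nat 11 i = s.nat 11 i) ∧
        HoldsEdges s' b (dropBelow t E) := by
  let Inv : ℕ → State → Prop := fun j s' =>
    AgreeOff [10, 11, 25, 32, 33, 34] s s' ∧ s'.num = s.num ∧
    (∀ i < b, s'.nat 10 i = s.nat 10 i ∧ s'.nat 11 i = s.nat 11 i) ∧ s'.nat 25 0 = j ∧
    ∀ i : Fin m, i.val < j → s'.nat 10 (b + i) = (dropBelow t E i).1 ∧
      s'.nat 11 (b + i) = (dropBelow t E i).2
  refine (Runs.loopUpTo m Inv ?_ ?_ ?_).mono le_rfl ?_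
  · rintro j - s' ⟨hf, -, -, h25, -⟩
    rw [holds_ltTest, scalar_eval, scalar_eval, h25, hf 1 (by decide), hm]
  · rintro j hjm s' ⟨hf, hn, hlow, h25, hd⟩
    refine Program.Straight.runs_of
      (by simp [rootEdgeBody, block, Program.Straight, increment, setScalar]) ?_
    have g2 : s'.nat 2 j = (E ⟨j, hjm⟩).1 := by rw [hf 2 (by decide)]; exact (hE ⟨j, hjm⟩).1
    have g3 : s'.nat 3 j = (E ⟨j, hjm⟩).2 := by rw [hf 3 (by decide)]; exact (hE ⟨j, hjm⟩).2
    have g23 : s'.nat 23 0 = t := by rw [hf 23 (by decide), ht]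
    have g24 : s'.nat 24 0 = b := by rw [hf 24 (by decide), hb]
    obtain ⟨s₁, hs₁, hs₁n, hr⟩ : ∃ s₁ : State, AgreeOff [32, 33, 34] s' s₁ ∧ s₁.num = s'.num ∧
        rootEdgeBody.run s' = ((s₁.setNat 10 (b + j) (dropBelow t E ⟨j, hjm⟩).1).setNat 11 (b + j)
          (dropBelow t E ⟨j, hjm⟩).2).setNat 25 0 (j + 1) := by
      by_cases c1 : t ≤ (E ⟨j, hjm⟩).1.val <;> by_cases c2 : t ≤ (E ⟨j, hjm⟩).2.val
      · refine ⟨(((s'.setNat 32 0 (E ⟨j, hjm⟩).1).setNat 33 0 (E ⟨j, hjm⟩).2).setNat 34 0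
          (E ⟨j, hjm⟩).1).setNat 34 0 (E ⟨j, hjm⟩).2, fun x hx i => ?_, rfl, ?_⟩
        · simp only [List.mem_cons, List.not_mem_nil, or_false, not_or] at hx
          simp [hx]
        · simp [rootEdgeBody, block, Program.run, setScalar, NatExp.eval, Test.Holds, increment,
            ComplexRAM.tailAddr, h25, g2, g3, g23, g24, dropBelow, c1, c2]
      all_goals
        refine ⟨((s'.setNat 32 0 (E ⟨j, hjm⟩).1).setNat 33 0 (E ⟨j, hjm⟩).2).setNat 34 0
          (E ⟨j, hjm⟩).1, fun x hx i => ?_, rfl, ?_⟩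
        · simp only [List.mem_cons, List.not_mem_nil, or_false, not_or] at hx
          simp [hx]
        · simp [rootEdgeBody, block, Program.run, setScalar, NatExp.eval, Test.Holds, increment,
            ComplexRAM.tailAddr, h25, g2, g3, g23, g24, dropBelow, c1, c2]
    have f10 (i) : s₁.nat 10 i = s'.nat 10 i := hs₁ 10 (by decide) i
    have f11 (i) : s₁.nat 11 i = s'.nat 11 i := hs₁ 11 (by decide) i
    rw [hr]
    refine ⟨fun x hx i => ?_, by simp [hs₁n, hn], fun i hi => ?_, by simp, fun i hi => ?_⟩
    · have hx' := hx
      simp only [List.mem_cons, List.not_mem_nil, or_false, not_or] at hx'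
      simp only [State.setNat_nat, hx', false_and, if_false]
      rw [hs₁ x (by simp [hx']), hf x hx]
    · have : i ≠ b + j := by omega
      simp [this, f10, f11, hlow i hi]
    · by_cases hi' : i.val = j
      · obtain rfl : i = ⟨j, hjm⟩ := Fin.ext hi'
        simp
      · simp [hi', f10, f11, hd i (by omega)]
  · exact ⟨fun _ _ _ => rfl, rfl, fun _ _ => ⟨rfl, rfl⟩, hj,
      fun i hi => absurd hi (Nat.not_lt_zero _)⟩
  · rintro s' ⟨hf, hn, hlow, -, hd⟩
    exact ⟨hf, hn, hlow, fun i => hd i i.2⟩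

def rootBody : Program :=
  .seq (block [.setNat 12 (scalar 23) (scalar 20), .setNat 13 (scalar 23) (scalar 23),
      setScalar 25 (.const 0)])
    (.seq rootEdgeLoop (block [setScalar 24 (.add (scalar 24) (scalar 1)), increment 23]))

/-- Write the roots of the forest. -/
def rootLoop : Program := .loop (ltTest (scalar 23) (scalar 0)) rootBody

theorem exists_runs_rootLoop : ∃ c : ℕ, ∀ {m n : ℕ} {s : State} {E : Fin m → Fin n × Fin n} {K : ℕ},
    s.nat 0 0 = n → s.nat 1 0 = m →
    (∀ i : Fin m, s.nat 2 i = (E i).1 ∧ s.nat 3 i = (E i).2) → s.nat 20 0 = K →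
    s.nat 23 0 = 0 → s.nat 24 0 = 0 →
    Runs rootLoop s (c * ((n + 1) * (m + 1))) fun s' =>
      AgreeOff [10, 11, 12, 13, 23, 24, 25, 32, 33, 34] s s' ∧ s'.num = s.num ∧
      s'.nat 23 0 = n ∧ s'.nat 24 0 = n * m ∧
      ∀ i : Fin n, HoldsNode s' i K i (dropBelow i E) := by
  refine ⟨(ltTest (scalar 23) (scalar 0)).cost +
    ((block [.setNat 12 (scalar 23) (scalar 20), .setNat 13 (scalar 23) (scalar 23),
      setScalar 25 (.const 0)]).bound + ((ltTest (scalar 25) (scalar 1)).cost +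
      rootEdgeBody.bound + (block [setScalar 24 (.add (scalar 24) (scalar 1)),
        increment 23]).bound)), ?_⟩
  intro m n s E K hn0 hm hE hK h23 h24
  let Inv : ℕ → State → Prop := fun t s' =>
    AgreeOff [10, 11, 12, 13, 23, 24, 25, 32, 33, 34] s s' ∧ s'.num = s.num ∧
    s'.nat 23 0 = t ∧ s'.nat 24 0 = t * m ∧
    ∀ i : Fin n, i.val < t → HoldsNode s' i K i (dropBelow i E)
  refine (Runs.loopUpTo n (T := (block [.setNat 12 (scalar 23) (scalar 20),
      .setNat 13 (scalar 23) (scalar 23), setScalar 25 (.const 0)]).bound +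
      (m * ((ltTest (scalar 25) (scalar 1)).cost + rootEdgeBody.bound) +
        (ltTest (scalar 25) (scalar 1)).cost + (block [setScalar 24 (.add (scalar 24) (scalar 1)),
        increment 23]).bound)) Inv ?_ ?_ ?_).mono ?_ ?_
  · rintro t - s' ⟨hf, -, h23, -⟩
    rw [holds_ltTest, scalar_eval, scalar_eval, h23, hf 0 (by decide), hn0]
  · rintro t htn s' ⟨hf, hn, g23, g24, hd⟩
    have hst : (block [.setNat 12 (scalar 23) (scalar 20), .setNat 13 (scalar 23) (scalar 23),
      setScalar 25 (.const 0)]).Straight := by simp [block, Program.Straight, setScalar]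
    have g20 : s'.nat 20 0 = K := by rw [hf 20 (by decide), hK]
    refine (hst.runs s').seq fun s₁ h₁ => ?_
    have e : s₁ = ((s'.setNat 12 t K).setNat 13 t t).setNat 25 0 0 := by
      rw [h₁]; simp [block, Program.run, setScalar, NatExp.eval, g23, g20]
    refine (runs_rootEdgeLoop (s := s₁) (E := E) (t := t) (b := t * m)
      (by simp [e, hf 1 (by decide), hm])
      (fun i => by simpa [e, hf 2 (by decide), hf 3 (by decide)] using hE i)
      (by simp [e, g23]) (by simp [e, g24]) (by simp [e])).seq fun s₂ ⟨hf₂, hn₂, hlow, hed⟩ =>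
        Program.Straight.runs_of (by simp [block, Program.Straight, setScalar, increment]) ?_
    have k1 : s₂.nat 1 0 = m := by rw [hf₂ 1 (by decide), e]; simp [hf 1 (by decide), hm]
    have k23 : s₂.nat 23 0 = t := by rw [hf₂ 23 (by decide), e]; simp [g23]
    have k24 : s₂.nat 24 0 = t * m := by rw [hf₂ 24 (by decide), e]; simp [g24]
    have hr : (block [setScalar 24 (.add (scalar 24) (scalar 1)), increment 23]).run s₂ =
        (s₂.setNat 24 0 ((t + 1) * m)).setNat 23 0 (t + 1) := by
      simp [block, Program.run, setScalar, increment, NatExp.eval, k1, k23, k24, Nat.succ_mul]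
    rw [hr]
    refine ⟨fun x hx i => ?_, ?_, by simp, by simp, fun i hi => ?_⟩
    · have hx' := hx
      simp only [List.mem_cons, List.not_mem_nil, or_false, not_or] at hx'
      simp only [State.setNat_nat, hx', false_and, if_false]
      rw [hf₂ x (by simp [hx']), e]
      simp [hx', hf x hx]
    · simp [hn₂, e, hn]
    · have d12 : s₂.nat 12 i = if i.val = t then K else s'.nat 12 i := by
        rw [hf₂ 12 (by decide), e]; simp
      have d13 : s₂.nat 13 i = if i.val = t then t else s'.nat 13 i := by
        rw [hf₂ 13 (by decide), e]; simp
      by_cases hi' : i.val = t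
      · rw [if_pos hi'] at d12 d13
        refine ⟨by simp [d12], by simpa [hi'] using d13.trans hi'.symm, ?_⟩
        rw [hi']
        simpa [HoldsEdges] using hed
      · have hN := hd i (by omega)
        refine ⟨by simp [d12, hi', hN.depth], by simp [d13, hi', hN.vertex], fun j => ?_⟩
        -- The edges of an earlier root lie below the address t · m, from which the current root is
        -- written.
        have := hlow _ (add_lt_mul_of_lt (show i.val < t by omega) j.2)
        have h3 := hN.edges j
        simp only [e] at this
        simp at this ⊢
        rw [this.1, this.2]
        exact h3
  · exact ⟨fun _ _ _ => rfl, rfl, h23, by simpa using h24,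
      fun i hi => absurd hi (Nat.not_lt_zero _)⟩
  · generalize (ltTest (scalar 23) (scalar 0)).cost = A
    generalize (block [.setNat 12 (scalar 23) (scalar 20), .setNat 13 (scalar 23) (scalar 23),
      setScalar 25 (.const 0)]).bound = B
    generalize (ltTest (scalar 25) (scalar 1)).cost = C
    generalize rootEdgeBody.bound = D
    generalize (block [setScalar 24 (.add (scalar 24) (scalar 1)), increment 23]).bound = F
    calc _ ≤ (n + 1) * (A + (B + (m * (C + D) + C + F))) := by nlinarith
      _ ≤ (n + 1) * ((A + (B + (C + D + F))) * (m + 1)) := by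
        refine Nat.mul_le_mul_left _ ?_
        nlinarith [Nat.zero_le (A * m), Nat.zero_le (B * m), Nat.zero_le (F * m)]
      _ = _ := by ring
  · rintro s' ⟨hf, hn, a, b, hd⟩
    exact ⟨hf, hn, a, b, fun i => hd i i.2⟩

/-! ### Choosing the depth -/

def depthBody : Program := block
  [setNumScalar 6 (.add (numScalar 6) (numScalar 6)), increment 20]

/-- The test `2 ^ k * ε ≤ C * n`. -/
def depthTest (C : ℕ) : Test :=
  .reLe (.mul (numScalar 6) (numScalar 2)) (.mul (.ofNat (.const C)) (.ofNat (scalar 0)))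

def depthInit : Program := block
  [ .branch (.reLe (.ofNat (.const 1)) (numScalar 2)) (setNumScalar 2 (.ofNat (.const 1))) .skip,
    setNumScalar 6 (.ofNat (.const 1)) ]

/-- Compute the depth of the roots. -/
def chooseDepth (C : ℕ) : Program := .seq depthInit (.loop (depthTest C) depthBody)

/-- K is the least depth that is sufficient for the accuracy. Minimality makes K the exit time of
the search loop and bounds 2^K, since K - 1 fails; for K = 0 the bound holds because n is replaced
by max(n, 1). -/
theorem exists_depth {C n : ℕ} (hC : 1 ≤ C) {ε : ℝ} (hε : 0 < ε) :
    ∃ K : ℕ, C * n < 2 ^ K * min ε 1 ∧ (∀ j < K, 2 ^ j * min ε 1 ≤ C * n) ∧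
      (2 : ℝ) ^ K ≤ 2 * C * (max (n : ℝ) 1 / min ε 1) := by
  classical
  have hδ : 0 < min ε 1 := lt_min hε one_pos
  have hex : ∃ K : ℕ, (C * n : ℝ) < 2 ^ K * min ε 1 := by
    obtain ⟨K, hK⟩ := pow_unbounded_of_one_lt (C * n / min ε 1 : ℝ) (one_lt_two)
    exact ⟨K, by rwa [div_lt_iff₀ hδ] at hK⟩
  have hmin : ∀ j < Nat.find hex, 2 ^ j * min ε 1 ≤ C * n :=
    fun j hj => not_lt.1 (Nat.find_min hex hj)
  refine ⟨Nat.find hex, Nat.find_spec hex, hmin, ?_⟩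
  have hC' : (1 : ℝ) ≤ C := by exact_mod_cast hC
  rcases hK : Nat.find hex with _ | K
  · have : 1 ≤ max (n : ℝ) 1 / min ε 1 := by
      rw [le_div_iff₀ hδ, one_mul]
      exact (min_le_right _ _).trans (le_max_right _ _)
    rw [pow_zero]
    nlinarith
  · have h1 := hmin K (by omega)
    rw [pow_succ, mul_div_assoc', le_div_iff₀ hδ]
    have : (C * n : ℝ) ≤ C * max (n : ℝ) 1 := by gcongr; exact le_max_left _ _
    linarith

theorem exists_runs_chooseDepth (C : ℕ) : ∃ c : ℕ, ∀ {s : State} {ε : ℝ} {K : ℕ},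
    s.num 2 0 = ε → s.nat 20 0 = 0 → C * (s.nat 0 0 : ℝ) < 2 ^ K * min ε 1 →
    (∀ j < K, 2 ^ j * min ε 1 ≤ C * (s.nat 0 0 : ℝ)) →
    Runs (chooseDepth C) s (c * (K + 1)) fun s' => AgreeOff [20] s s' ∧ s'.nat 20 0 = K ∧
      ∀ x i, x ≠ 2 → x ≠ 6 → s'.num x i = s.num x i := by
  refine ⟨depthInit.bound + ((depthTest C).cost + depthBody.bound), ?_⟩
  intro s ε K h2 h20 hK hmin
  have hst : depthInit.Straight := by simp [depthInit, block, Program.Straight, setNumScalar]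
  refine ((hst.runs s).seq (T' := K * ((depthTest C).cost + depthBody.bound) + (depthTest C).cost)
    fun s₁ h₁ => ?_).mono ?_ fun _ h => h
  swap
  · generalize depthInit.bound = A
    generalize (depthTest C).cost = B
    generalize depthBody.bound = D
    nlinarith [Nat.zero_le (A * K)]
  have e : s₁.nat = s.nat ∧ s₁.num 6 0 = 1 ∧ s₁.num 2 0 = ((min ε 1 : ℝ) : ℂ) ∧
      ∀ x i, x ≠ 2 → x ≠ 6 → s₁.num x i = s.num x i := by
    rw [h₁]
    by_cases h : 1 ≤ ε
    · simp +contextual [depthInit, block, Program.run, Test.Holds, NumExp.eval, NatExp.eval,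
        setNumScalar, h2, h]
    · simp +contextual [depthInit, block, Program.run, Test.Holds, NumExp.eval, NatExp.eval,
        setNumScalar, h2, h, min_eq_left (not_le.1 h).le]
  obtain ⟨e1, e2, e3, e4⟩ := e
  refine (Runs.loopUpTo K (fun j s' => AgreeOff [20] s s' ∧ s'.nat 20 0 = j ∧
    (∀ x i, x ≠ 2 → x ≠ 6 → s'.num x i = s.num x i) ∧ s'.num 6 0 = ((2 ^ j : ℝ) : ℂ) ∧
    s'.num 2 0 = ((min ε 1 : ℝ) : ℂ)) ?_ ?_ ?_).mono le_rfl ?_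
  · rintro j hj s' ⟨hf, h20, -, h6, h2⟩
    -- Both sides of the test are real numbers, so comparing real parts decides the inequality
    -- exactly.
    have hiff : (depthTest C).Holds s' ↔ 2 ^ j * min ε 1 ≤ C * (s.nat 0 0 : ℝ) := by
      simp only [depthTest, Test.Holds, NumExp.eval, NatExp.eval, numScalar_eval, scalar_eval, h6,
        h2, hf 0 (by decide), ← Complex.ofReal_mul, ← Complex.ofReal_natCast, Complex.ofReal_re]
    rw [hiff]
    refine ⟨fun h => ?_, hmin j⟩
    rcases hj.lt_or_eq with h' | rfl
    · exact h'
    · exact absurd h (not_le.2 hK)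
  · rintro j - s' ⟨hf, h20, hn, h6, h2⟩
    refine Program.Straight.runs_of
      (by simp [depthBody, block, Program.Straight, setNumScalar, increment, setScalar]) ?_
    have hr : depthBody.run s' = (s'.setNum 6 0 (s'.num 6 0 + s'.num 6 0)).setNat 20 0 (j + 1) := by
      simp [depthBody, block, Program.run, setNumScalar, increment, setScalar, NumExp.eval,
        NatExp.eval, h20]
    rw [hr]
    refine ⟨fun x hx i => ?_, by simp, fun x i hx hx' => by simp [hx', hn x i hx hx'], ?_,
      by simp [h2]⟩
    · rw [← hf x hx i]
      simp only [List.mem_cons, List.not_mem_nil, or_false] at hx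
      simp [hx]
    · simp only [State.setNat_num, State.setNum_num, and_self, if_true, h6]
      rw [pow_succ, ← Complex.ofReal_add]
      congr 1
      ring
  · exact ⟨fun x _ i => by rw [e1], by rw [e1, h20], e4, by simp [e2], e3⟩
  · rintro s' ⟨hf, h20, hn, -, -⟩
    exact ⟨hf, h20, hn⟩

/-! ### The whole program and its running time -/

/-- The algorithm. -/
def mainProgram (C : ℕ) : Program :=
  .seq (chooseDepth C) (.seq rootLoop (.seq growLoop (.seq evaluateLoop multiply)))

theorem exists_runs_mainProgram (C : ℕ) : ∃ c : ℕ, ∀ {α β : Type} {G : Graph α β} (L : G.EdgeList)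
    {q w : ℂ} {ε : ℝ} {K : ℕ}, C * (L.n : ℝ) < 2 ^ K * min ε 1 →
    (∀ j < K, 2 ^ j * min ε 1 ≤ C * (L.n : ℝ)) →
    Runs (mainProgram C) (input L q w ε) (c * ((K + 1 + L.n * 4 ^ K) * (L.m + 1))) fun s' =>
      ∃ x : Fin L.n → ℂ, s'.output = ∏ i, q * x i ∧
        ∀ i : Fin L.n, IsApproxRatio q w K (dropBelow i L.ends) i (x i) := by
  obtain ⟨c₁, h₁⟩ := exists_runs_chooseDepth C
  obtain ⟨c₂, h₂⟩ := exists_runs_rootLoop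
  obtain ⟨c₃, h₃⟩ := exists_runs_growLoop
  obtain ⟨c₄, h₄⟩ := exists_runs_evaluateLoop
  obtain ⟨c₅, h₅⟩ := exists_runs_multiply
  refine ⟨c₁ + c₂ + c₃ + c₄ + c₅, ?_⟩
  intro α β G L q w ε K hK hmin
  set B := L.n * 4 ^ K with hB
  have hnB : L.n ≤ B := Nat.le_mul_of_pos_right _ (by positivity)
  refine Runs.mono (T := c₁ * (K + 1) + (c₂ * ((L.n + 1) * (L.m + 1)) +
    (c₃ * ((B + 1) * (L.m + 1)) + (c₄ * (B + 1) + c₅ * (L.n + 1))))) ?_ ?_ fun _ h => h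
  · refine (h₁ (s := input L q w ε) (K := K) (ε := ε) (by simp [input]) (by simp [input])
      (by simpa [input] using hK) (by simpa [input] using hmin)).seq fun s₁ ⟨f₁, d₁, n₁⟩ => ?_
    refine (h₂ (s := s₁) (E := L.ends) (K := K) (n := L.n) (by rw [f₁ 0 (by decide)]; simp [input])
      (by rw [f₁ 1 (by decide)]; simp [input]) (fun i => ?_) d₁
      (by rw [f₁ 23 (by decide)]; simp [input])
      (by rw [f₁ 24 (by decide)]; simp [input])).seq fun s₂ ⟨f₂, n₂, t₂, b₂, r₂⟩ => ?_
    · rw [f₁ 2 (by decide), f₁ 3 (by decide)]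
      simp [input, Graph.EdgeList.ends]
    have g (x : ℕ) (hx : x ∉ [10, 11, 12, 13, 20, 23, 24, 25, 32, 33, 34]) (i : ℕ) :
        s₂.nat x i = (input L q w ε).nat x i := by
      simp only [List.mem_cons, List.not_mem_nil, or_false, not_or] at hx
      rw [f₂ x (by simp [hx]), f₁ x (by simp [hx])]
    have hI : ForestInv q w K L.ends 0 L.n s₂ := by
      refine ⟨by rw [g 0 (by decide)]; simp [input], by rw [g 1 (by decide)]; simp [input],
        by rw [n₂, n₁ 0 0 (by decide) (by decide)]; simp [input],
        by rw [n₂, n₁ 1 0 (by decide) (by decide)]; simp [input],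
        by rw [g 21 (by decide)]; simp [input], by rw [g 22 (by decide)]; simp [input],
        t₂, b₂, Nat.zero_le _, le_rfl, r₂, fun i hi => ⟨_, _, _, r₂ ⟨i, hi⟩⟩,
        fun i hi => absurd hi (Nat.not_lt_zero _),
        fun i _ => by rw [g 14 (by decide)]; simp [input], ?_⟩
      -- Initially nothing has been processed and there are n roots of depth K, so the potential
      -- equals n · 4^K.
      rw [Finset.sum_congr rfl (g := fun _ => 4 ^ K) fun i hi => by
        rw [(r₂ ⟨i, (Finset.mem_Ico.1 hi).2⟩).depth]]
      simp
    refine (h₃ hI).seq fun s₃ ⟨T, hT, hI₃⟩ => ?_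
    refine ((h₄ (q := q) (w := w) hI₃.head hI₃.resolved).mono
      (Nat.mul_le_mul_left c₄ (Nat.succ_le_succ hT)) fun _ h => h).seq
      fun s₄ ⟨f₄, n₄, v₄⟩ => ?_
    have hn₄ : s₄.nat 0 0 = L.n := by rw [f₄ 0 (by decide), hI₃.vertices]
    have hq₄ : s₄.num 0 0 = q := by rw [n₄ 0 0 (by decide), hI₃.param_q]
    refine ((h₅ s₄).mono (T' := c₅ * (L.n + 1)) (by rw [hn₄]) fun s₅ h => ?_)
    refine ⟨fun i => s₄.num 5 i, ?_, fun i => ?_⟩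
    · rw [h, hq₄, Fin.prod_univ_eq_prod_range (fun i => q * s₄.num 5 i),
        Fin.prod_univ_eq_prod_range (fun i => q * s₄.num 5 i), hn₄]
    · exact v₄ i (i.2.trans_le hI₃.le_tail) K i _ (hI₃.roots i)
  · set M := L.m + 1 with hM
    have hM1 : 1 ≤ M := by omega
    set Y := (K + 1 + B) * M with hY
    have y0 : K + 1 + B ≤ Y := Nat.le_mul_of_pos_right _ hM1
    have y2 : (L.n + 1) * M ≤ Y := Nat.mul_le_mul_right _ (by omega)
    have y3 : (B + 1) * M ≤ Y := Nat.mul_le_mul_right _ (by omega)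
    have z1 := Nat.mul_le_mul_left c₁ (show K + 1 ≤ Y by omega)
    have z2 := Nat.mul_le_mul_left c₂ y2
    have z3 := Nat.mul_le_mul_left c₃ y3
    have z4 := Nat.mul_le_mul_left c₄ (show B + 1 ≤ Y by omega)
    have z5 := Nat.mul_le_mul_left c₅ (show L.n + 1 ≤ Y by omega)
    calc _ ≤ c₁ * Y + (c₂ * Y + (c₃ * Y + (c₄ * Y + c₅ * Y))) := by omega
      _ = _ := by ring

/-- The running time in terms of `X = max n 1 / min ε 1`. -/
theorem time_le {C Δ c K n m t : ℕ} {X : ℝ} (hX : 1 ≤ X) (hn : (n : ℝ) ≤ X) (hm : m ≤ n * Δ)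
    (hK : (2 : ℝ) ^ K ≤ 2 * C * X) (ht : t ≤ c * ((K + 1 + n * 4 ^ K) * (m + 1))) :
    (t : ℝ) ≤ (c * ((2 * C + 1 + 4 * C ^ 2) * (Δ + 1)) + 4 : ℕ) *
      X ^ (c * ((2 * C + 1 + 4 * C ^ 2) * (Δ + 1)) + 4) := by
  have hX0 : 0 ≤ X := by linarith
  have k1 : (K : ℝ) ≤ 2 * C * X := by
    refine le_trans ?_ hK
    exact_mod_cast (Nat.lt_two_pow_self (n := K)).le
  have k2 : (4 : ℝ) ^ K ≤ 4 * C ^ 2 * X ^ 2 := by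
    have : (4 : ℝ) ^ K = (2 ^ K) ^ 2 := by rw [← pow_mul, mul_comm, pow_mul]; norm_num
    rw [this]
    calc ((2 : ℝ) ^ K) ^ 2 ≤ (2 * C * X) ^ 2 := by gcongr
      _ = _ := by ring
  have x3 : X ≤ X ^ 3 := le_self_pow₀ hX (by norm_num)
  have x3' : 1 ≤ X ^ 3 := one_le_pow₀ hX
  have hm' : (m : ℝ) + 1 ≤ (Δ + 1) * X := by
    have : (m : ℝ) ≤ n * Δ := by exact_mod_cast hm
    have : (n : ℝ) * Δ ≤ X * Δ := by gcongr
    linarith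
  have h1 : (K : ℝ) + 1 + n * 4 ^ K ≤ (2 * C + 1 + 4 * C ^ 2) * X ^ 3 := by
    have a1 : (n : ℝ) * 4 ^ K ≤ X * (4 * C ^ 2 * X ^ 2) := by gcongr
    have a2 : 2 * (C : ℝ) * X ≤ 2 * C * X ^ 3 := by gcongr
    linarith
  -- With X ≥ 1 the time is at most S · X^4: the forest contributes X^3 and the edges of a node X.
  -- The number S + 4 then serves both as the factor and as the exponent.
  set S := c * ((2 * C + 1 + 4 * C ^ 2) * (Δ + 1)) with hS
  have hSr : (S : ℝ) = c * ((2 * C + 1 + 4 * C ^ 2) * (Δ + 1)) := by rw [hS]; push_cast; ring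
  calc (t : ℝ) ≤ c * ((K + 1 + n * 4 ^ K) * (m + 1)) := by exact_mod_cast ht
    _ ≤ c * (((2 * C + 1 + 4 * C ^ 2) * X ^ 3) * ((Δ + 1) * X)) := by gcongr
    _ = S * X ^ 4 := by rw [hSr]; ring
    _ ≤ (S + 4 : ℕ) * X ^ (S + 4) := by
      gcongr
      · omega
      · omega

end ComplexRAM

theorem theorem1p4 (Δ : ℕ) (w : ℂ) :
    ∃ K : ℝ, ∀ q : ℂ, K < ‖q‖ →
      ∃ (P : ComplexRAM.Program) (C : ℕ),
        ∀ (α β : Type) (G : Graph α β), G.Loopless → (∀ v ∈ V(G), G.degree v ≤ Δ) →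
          ∀ (L : G.EdgeList) (ε : ℝ), 0 < ε →
            ∃ (s : ComplexRAM.State) (t : ℕ),
              ComplexRAM.Exec P (ComplexRAM.input L q w ε) s t ∧
              IsMultApprox ε (G.tutte q w) s.output ∧
              (t : ℝ) ≤ C * (max (V(G).ncard : ℝ) 1 / min ε 1) ^ C := by
  -- The first factor bounds |(1 + w)^j - 1| for all j ≤ Δ; the second is the smallness of the
  -- contraction weights required by `ratio_bound`.
  refine ⟨((1 + ‖w‖) ^ Δ + 1) * (32 * 16 ^ Δ), fun q hq => ?_⟩
  have hq0 : 0 < ‖q‖ := lt_trans (by positivity) hq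
  have hc : ∀ j ≤ Δ, ‖((1 + w) ^ j - 1) / q‖ * (32 * 16 ^ Δ) ≤ 1 := by
    intro j hj
    have h1 : ‖(1 + w) ^ j - 1‖ ≤ (1 + ‖w‖) ^ Δ + 1 := by
      refine (norm_sub_le _ _).trans ?_
      rw [norm_pow, norm_one]
      gcongr
      calc ‖1 + w‖ ^ j ≤ (1 + ‖w‖) ^ j := by
            gcongr; exact (norm_add_le _ _).trans (by rw [norm_one])
        _ ≤ (1 + ‖w‖) ^ Δ := pow_le_pow_right₀ (by linarith [norm_nonneg w]) hj
    rw [norm_div, div_mul_eq_mul_div, div_le_one hq0]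
    exact (mul_le_mul_of_nonneg_right h1 (by positivity)).trans hq.le
  -- The constant 16 · 4^Δ is the one that `isMultApprox_prod` demands of the depth.
  obtain ⟨c, hrun⟩ := ComplexRAM.exists_runs_mainProgram (16 * 4 ^ Δ)
  refine ⟨ComplexRAM.mainProgram (16 * 4 ^ Δ),
    c * ((2 * (16 * 4 ^ Δ) + 1 + 4 * (16 * 4 ^ Δ) ^ 2) * (Δ + 1)) + 4, fun α β G hG hΔ L ε hε => ?_⟩
  obtain ⟨K, hK, hmin, hK'⟩ := ComplexRAM.exists_depth (C := 16 * 4 ^ Δ) (n := L.n)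
    (Nat.one_le_iff_ne_zero.2 (by positivity)) hε
  obtain ⟨s, t, hexec, ht, x, hx, hval⟩ := hrun L (q := q) (w := w) hK hmin
  refine ⟨s, t, hexec, ?_, ?_⟩
  · rw [hx, L.tutte_eq_clusterSum hG]
    refine EdgeFamily.isMultApprox_prod (norm_pos_iff.1 hq0) hc L.ends
      (fun v => (L.liveDegree_ends_le v).trans (hΔ _ (L.vert v).2)) x hval hε ?_
    push_cast at hK
    exact hK.le
  · have hδ : 0 < min ε 1 := lt_min hε one_pos
    rw [L.card_vertexSet]
    refine ComplexRAM.time_le ?_ ?_ (L.m_le hG hΔ) hK' ht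
    · rw [le_div_iff₀ hδ, one_mul]
      exact (min_le_right _ _).trans (le_max_right _ _)
    · rw [le_div_iff₀ hδ]
      calc (L.n : ℝ) * min ε 1 ≤ L.n * 1 := by gcongr; exact min_le_right _ _
        _ ≤ _ := by rw [mul_one]; exact le_max_left _ _
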